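/- All graphs are finite, simple and nonempty. Let $G$ be a graph with $n$ vertices. A \emph{partition sequence} of $G$ is a sequence $\mathcal P_n,\dots,\mathcal P_1$ of partitions of $V(G)$ such that $\mathcal P_n$ is the partition into singletons, $\mathcal P_1=\{V(G)\}$, and for $1\le i<n$ the partition $\mathcal P_i$ is obtained from $\mathcal P_{i+1}$ by merging two parts. Two disjoint vertex sets $X,Y$ are \emph{homogeneous} if there are all edges or no edges between them. For a partition $\mathcal P$ of $V(G)$, the \emph{red graph} has vertex set $\mathcal P$ and an edge between distinct parts $X,Y$ whenever they are not homogeneous; the \emph{directed red graph} has vertex set $\mathcal P$ and an arc $X\to Y$, for distinct parts $X,Y$, whenever some $y\in Y$ has both a neighbor and a non-neighbor in $X$. The \emph{twin-width} $\mathrm{tww}(G)$ (resp. \emph{oriented twin-width} $\mathrm{otww}(G)$) is the least $t$ for which $G$ has a partition sequence such that for every $i$ the red graph of $\mathcal P_i$ has maximum degree at most $t$ (resp. the directed red graph of $\mathcal P_i$ has maximum out-degree at most $t$). A matrix is \emph{mixed} if it has a non-constant row and a non-constant column. A \emph{$t$-mixed minor} of a matrix is a partition of its rows into $t$ nonempty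 sets of consecutive rows and of its columns into $t$ nonempty sets of consecutive columns such that each of the $t^2$ zones so defined is mixed. The \emph{mixed value} of $G$ is the least $t\ge 1$ such that, for some linear order of $V(G)$, the adjacency matrix of $G$ with rows and columns in that order has no $t$-mixed minor. \textbf{Theorem.} Oriented twin-width and twin-width are functionally equivalent: there is a function $f:\mathbb N\to\mathbb N$ such that $\mathrm{otww}(G)\le f(\mathrm{tww}(G))$ and $\mathrm{tww}(G)\le f(\mathrm{otww}(G))$ for every graph $G$. More precisely, there is a constant $c$ such that $$\mathrm{otww}(G)\ \le\ \mathrm{tww}(G)\ \le\ \exp(\exp(c\cdot \mathrm{otww}(G)))$$ for every graph $G$. Moreover, for every graph $G$ and every integer $d\ge 0$, if the mixed value of $G$ is greater than $2d+2$, then $\mathrm{otww}(G)\ge d$. -/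

import Mathlib

universe u

namespace TwinWidth

section Partitions

variable {V : Type u} [Fintype V] [DecidableEq V]

/-- `P` is obtained from `Q` by merging two (distinct) parts of `Q`. -/
def IsMerge (Q P : Finpartition (Finset.univ : Finset V)) : Prop :=
  ∃ X ∈ Q.parts, ∃ Y ∈ Q.parts, X ≠ Y ∧ P.parts = insert (X ∪ Y) ((Q.parts.erase X).erase Y)

variable (V) in
/-- A partition sequence `P_n, …, P_1` of the vertex set, `n` being the number of vertices.
Only the values `part i` with `1 ≤ i ≤ n` are meaningful. -/
structure PartitionSequence where
  part : ℕ → Finpartition (Finset.univ : Finset V)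
  /-- `P_n` is the partition into singletons. -/
  finest : part (Fintype.card V) = ⊥
  /-- `P_1` has the whole vertex set as its only part. -/
  coarsest : (part 1).parts = {Finset.univ}
  /-- Each `P_i` is obtained by merging two parts of `P_{i+1}`. -/
  merge : ∀ i, 1 ≤ i → i < Fintype.card V → IsMerge (part (i + 1)) (part i)

/-- The partition-width associated to a width `w` (a function of a vertex-partitioned graph). -/
noncomputable def partitionWidth
    (w : SimpleGraph V → Finpartition (Finset.univ : Finset V) → ℕ) (G : SimpleGraph V) : ℕ :=
  sInf {t | ∃ S : PartitionSequence V, ∀ i, 1 ≤ i → i ≤ Fintype.card V → w G (S.part i) ≤ t}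

/-- Two disjoint vertex sets are homogeneous if there are all edges or no edge between them. -/
def Homogeneous (G : SimpleGraph V) (X Y : Finset V) : Prop :=
  (∀ x ∈ X, ∀ y ∈ Y, G.Adj x y) ∨ (∀ x ∈ X, ∀ y ∈ Y, ¬ G.Adj x y)

/-- `Y` is homogeneous to `X` if the pair `X, {y}` is homogeneous for every `y ∈ Y`. -/
def HomogeneousTo (G : SimpleGraph V) (Y X : Finset V) : Prop :=
  ∀ y ∈ Y, Homogeneous G X {y}

/-- Red edges of the quotient trigraph (no red loops). -/
def RedEdge (G : SimpleGraph V) (X Y : Finset V) : Prop :=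
  X ≠ Y ∧ ¬ Homogeneous G X Y

/-- Red arcs `X → Y` of the directed red graph (no red loops): `Y` is not homogeneous to `X`,
i.e. some vertex of `Y` has both a neighbor and a non-neighbor in `X`. -/
def RedArc (G : SimpleGraph V) (X Y : Finset V) : Prop :=
  X ≠ Y ∧ ¬ HomogeneousTo G Y X

open Classical in
/-- The maximum red degree of the quotient trigraph `G / P`. -/
noncomputable def redDegreeWidth (G : SimpleGraph V)
    (P : Finpartition (Finset.univ : Finset V)) : ℕ :=
  P.parts.sup fun X => (P.parts.filter fun Y => RedEdge G X Y).card

open Classical in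
/-- The maximum red out-degree of the directed trigraph of `G` and `P`. -/
noncomputable def redOutDegreeWidth (G : SimpleGraph V)
    (P : Finpartition (Finset.univ : Finset V)) : ℕ :=
  P.parts.sup fun X => (P.parts.filter fun Y => RedArc G X Y).card

end Partitions

/-- Twin-width of a (finite, nonempty) graph. -/
noncomputable def tww (V : Type u) [Fintype V] [DecidableEq V] (G : SimpleGraph V) : ℕ :=
  partitionWidth redDegreeWidth G

/-- Oriented twin-width of a (finite, nonempty) graph. -/
noncomputable def otww (V : Type u) [Fintype V] [DecidableEq V] (G : SimpleGraph V) : ℕ :=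
  partitionWidth redOutDegreeWidth G

/-- Functional equivalence of two parameters of finite nonempty graphs. -/
def FunctionallyEquivalent
    (w w' : ∀ (V : Type u) [Fintype V] [DecidableEq V], SimpleGraph V → ℕ) : Prop :=
  ∃ f : ℕ → ℕ, ∀ (V : Type u) [Fintype V] [DecidableEq V] [Nonempty V] (G : SimpleGraph V),
    w V G ≤ f (w' V G) ∧ w' V G ≤ f (w V G)

section Matrices

variable {n m : ℕ} {α : Type*}

/-- The zone of `M` with rows `R` and columns `C` is vertical: each of its columns is constant. -/
def IsVertical (M : Matrix (Fin n) (Fin m) α) (R : Finset (Fin n)) (C : Finset (Fin m)) : Prop :=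
  ∀ i ∈ R, ∀ i' ∈ R, ∀ j ∈ C, M i j = M i' j

/-- The zone of `M` with rows `R` and columns `C` is horizontal: each of its rows is constant. -/
def IsHorizontal (M : Matrix (Fin n) (Fin m) α) (R : Finset (Fin n)) (C : Finset (Fin m)) : Prop :=
  ∀ i ∈ R, ∀ j ∈ C, ∀ j' ∈ C, M i j = M i j'

/-- The zone is mixed: neither vertical nor horizontal. -/
def IsMixed (M : Matrix (Fin n) (Fin m) α) (R : Finset (Fin n)) (C : Finset (Fin m)) : Prop :=
  ¬ IsVertical M R C ∧ ¬ IsHorizontal M R C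

/-- A division of `Fin n`: every part consists of consecutive indices. -/
def IsDivision (P : Finpartition (Finset.univ : Finset (Fin n))) : Prop :=
  ∀ X ∈ P.parts, (X : Set (Fin n)).OrdConnected

/-- `M` has a `t`-mixed minor: a `(t,t)`-division all of whose zones are mixed. -/
def HasMixedMinor (M : Matrix (Fin n) (Fin m) α) (t : ℕ) : Prop :=
  ∃ (R : Finpartition (Finset.univ : Finset (Fin n)))
    (C : Finpartition (Finset.univ : Finset (Fin m))),
    IsDivision R ∧ IsDivision C ∧ R.parts.card = t ∧ C.parts.card = t ∧
      ∀ X ∈ R.parts, ∀ Y ∈ C.parts, IsMixed M X Y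

end Matrices

open Classical in
/-- The adjacency matrix with rows and columns listed in the vertex order `σ`. -/
noncomputable def orderedAdj {V : Type u} [Fintype V] (G : SimpleGraph V)
    (σ : Fin (Fintype.card V) ≃ V) :
    Matrix (Fin (Fintype.card V)) (Fin (Fintype.card V)) ℕ :=
  (G.adjMatrix ℕ).submatrix σ σ

/-- The mixed value of a graph: the least positive `t` such that, for some vertex order, the
adjacency matrix has no `t`-mixed minor. (`t = 0` has to be left out, as no nonempty matrix has a
division with zero parts.) -/
noncomputable def mixedValue {V : Type u} [Fintype V] (G : SimpleGraph V) : ℕ :=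
  sInf {t | 1 ≤ t ∧ ∃ σ : Fin (Fintype.card V) ≃ V, ¬ HasMixedMinor (orderedAdj G σ) t}

end TwinWidth

/-!
Order the vertices so that every part of a given partition sequence is an interval. In a mixed
minor, consider the first merge producing a part `X` that contains a whole row part or column part
`A`. Every part of the other division then contains a vertex with both a neighbor and a non-neighbor
in `X`, hence meets `X` or an out-neighbor of `X` in the directed red graph. As no part before the
merge contains a part of a division, each of these out-neighbors meets at most two parts of the
other division and `X` meets at most three. So small oriented twin-width excludes a large mixed
minor.

Conversely, exclude a mixed minor. Every mixed zone contains a corner, that is, a mixed contiguous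
`2 × 2` submatrix. The corners have no large grid minor, so by the Marcus–Tardos theorem only
linearly many zones of a division into `p` parts contain the top left entry of a corner. Starting
from singletons one can therefore merge consecutive parts while keeping the number of mixed zones of
each part bounded. Refining each of these divisions by the neighborhoods of the vertices outside the
mixed zones gives partitions into boundedly many pieces of each part, with red edges only inside
mixed zones.
-/

namespace TwinWidth

open Finset

section GridMinors

variable {α β : Type*} [Preorder α] [Preorder β]

/-- A `k`-grid minor of a relation: the rows and the columns are labelled monotonically, and every
zone with labels `a, b < k` contains a related pair. Labels `≥ k` are allowed, so that unused rows
and columns need not be assigned to a zone. -/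
def HasGridMinor (S : α → β → Prop) (k : ℕ) : Prop :=
  ∃ (f : α → ℕ) (g : β → ℕ), Monotone f ∧ Monotone g ∧
    ∀ a < k, ∀ b < k, ∃ x y, S x y ∧ f x = a ∧ g y = b

theorem HasGridMinor.swap {S : α → β → Prop} {k : ℕ} (h : HasGridMinor S k) :
    HasGridMinor (fun y x => S x y) k := by
  obtain ⟨f, g, hf, hg, hfg⟩ := h
  refine ⟨g, f, hg, hf, fun a ha b hb => ?_⟩
  obtain ⟨x, y, hxy, hx, hy⟩ := hfg b hb a ha
  exact ⟨y, x, hxy, hy, hx⟩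

theorem HasGridMinor.of_contraction {γ δ : Type*} [Preorder γ] [Preorder δ]
    {S : α → β → Prop} {T : γ → δ → Prop} {k : ℕ} {π : α → γ} {ρ : β → δ}
    (hπ : Monotone π) (hρ : Monotone ρ)
    (hST : ∀ a b, T a b → ∃ x y, S x y ∧ π x = a ∧ ρ y = b)
    (h : HasGridMinor T k) : HasGridMinor S k := by
  obtain ⟨f, g, hf, hg, hfg⟩ := h
  refine ⟨f ∘ π, g ∘ ρ, hf.comp hπ, hg.comp hρ, fun a ha b hb => ?_⟩
  obtain ⟨c, d, hcd, hc, hd⟩ := hfg a ha b hb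
  obtain ⟨x, y, hxy, rfl, rfl⟩ := hST c d hcd
  exact ⟨x, y, hxy, hc, hd⟩

theorem hasGridMinor_of_common_labelling {S : α → β → Prop} {k : ℕ} {π : α → ℕ} {g : β → ℕ}
    (hπ : Monotone π) (hg : Monotone g) {J : Finset ℕ} (hJ : k ≤ #J)
    (hSJ : ∀ c ∈ J, ∀ b < k, ∃ x y, S x y ∧ π x = c ∧ g y = b) : HasGridMinor S k := by
  refine ⟨fun x => Nat.count (· ∈ J) (π x), g, (Nat.count_monotone _).comp hπ, hg,
    fun a ha b hb => ?_⟩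
  have haJ (hf : {c | c ∈ J}.Finite) : a < #hf.toFinset := by simpa using ha.trans_le hJ
  obtain ⟨x, y, hxy, hx, hy⟩ := hSJ _ (Nat.nth_mem a haJ) b hb
  exact ⟨x, y, hxy, by simp only [hx, Nat.count_nth haJ], hy⟩

end GridMinors

section Bisection

/-- A family of monotone labellings such that every set of `2 ^ j` elements of `I` receives all
labels `0, …, j` from one of them. -/
structure IsLabellingFamily (𝒢 : Finset (ℕ → ℕ)) (j : ℕ) (I : Finset ℕ) : Prop where
  monotone : ∀ g ∈ 𝒢, Monotone g
  exists_range_subset : ∀ A ⊆ I, 2 ^ j ≤ #A → ∃ g ∈ 𝒢, range (j + 1) ⊆ A.image g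

theorem isLabellingFamily_zero (I : Finset ℕ) : IsLabellingFamily {0} 0 I where
  monotone g hg := by
    rw [mem_singleton.1 hg]
    exact monotone_const
  exists_range_subset A _ hA := by
    obtain ⟨y, hy⟩ : A.Nonempty := card_pos.1 (by simpa using hA)
    simpa using ⟨y, hy⟩

theorem isLabellingFamily_of_card_lt {j : ℕ} {I : Finset ℕ} (hI : #I < 2 ^ j) :
    IsLabellingFamily ∅ j I where
  monotone := by simp
  exists_range_subset A hAI hA := absurd (card_le_card hAI) (by omega)

/-- The labelling which agrees with `g` below `c`, except that the labels are capped at `j`, and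
has the new label `j + 1` from `c` on. -/
def appendLabel (c j : ℕ) (g : ℕ → ℕ) (y : ℕ) : ℕ := if y < c then min (g y) j else j + 1

/-- The labelling which has the new label `0` below `c` and is `g`, shifted by one, from `c` on. -/
def prependLabel (c : ℕ) (g : ℕ → ℕ) (y : ℕ) : ℕ := if y < c then 0 else g y + 1

theorem monotone_appendLabel (c j : ℕ) {g : ℕ → ℕ} (hg : Monotone g) :
    Monotone (appendLabel c j g) := by
  intro x y hxy
  have := hg hxy
  simp only [appendLabel]
  split_ifs <;> omega

theorem monotone_prependLabel (c : ℕ) {g : ℕ → ℕ} (hg : Monotone g) :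
    Monotone (prependLabel c g) := by
  intro x y hxy
  have := hg hxy
  simp only [prependLabel]
  split_ifs <;> omega

theorem range_subset_image_appendLabel {A : Finset ℕ} {c j : ℕ} {g : ℕ → ℕ}
    (hlow : range (j + 1) ⊆ {y ∈ A | y < c}.image g) (hhigh : {y ∈ A | ¬ y < c}.Nonempty) :
    range (j + 2) ⊆ A.image (appendLabel c j g) := by
  intro b hb
  rcases (Nat.lt_succ_iff.1 (mem_range.1 hb)).lt_or_eq with hbj | rfl
  · obtain ⟨y, hy, rfl⟩ := mem_image.1 (hlow (mem_range.2 hbj))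
    obtain ⟨hyA, hyc⟩ := mem_filter.1 hy
    exact mem_image.2 ⟨y, hyA, by simp only [appendLabel, if_pos hyc]; omega⟩
  · obtain ⟨y, hy⟩ := hhigh
    obtain ⟨hyA, hyc⟩ := mem_filter.1 hy
    exact mem_image.2 ⟨y, hyA, if_neg hyc⟩

theorem range_subset_image_prependLabel {A : Finset ℕ} {c j : ℕ} {g : ℕ → ℕ}
    (hlow : {y ∈ A | y < c}.Nonempty) (hhigh : range (j + 1) ⊆ {y ∈ A | ¬ y < c}.image g) :
    range (j + 2) ⊆ A.image (prependLabel c g) := by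
  rintro (_ | b) hb
  · obtain ⟨y, hy⟩ := hlow
    obtain ⟨hyA, hyc⟩ := mem_filter.1 hy
    exact mem_image.2 ⟨y, hyA, if_pos hyc⟩
  · have hbj : b ∈ range (j + 1) := mem_range.2 (Nat.succ_lt_succ_iff.1 (mem_range.1 hb))
    obtain ⟨y, hy, rfl⟩ := mem_image.1 (hhigh hbj)
    obtain ⟨hyA, hyc⟩ := mem_filter.1 hy
    exact mem_image.2 ⟨y, hyA, if_neg hyc⟩

open Classical in
theorem IsLabellingFamily.bisection {𝒢₁ 𝒢₂ 𝒢₃ 𝒢₄ : Finset (ℕ → ℕ)} {a b c j : ℕ}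
    (h₁ : IsLabellingFamily 𝒢₁ (j + 1) (Ico a b)) (h₂ : IsLabellingFamily 𝒢₂ (j + 1) (Ico b c))
    (h₃ : IsLabellingFamily 𝒢₃ j (Ico a b)) (h₄ : IsLabellingFamily 𝒢₄ j (Ico b c)) :
    IsLabellingFamily
      ((𝒢₁ ∪ 𝒢₂) ∪ (𝒢₃.image (appendLabel b j) ∪ 𝒢₄.image (prependLabel b))) (j + 1)
      (Ico a c) where
  monotone g hg := by
    simp only [mem_union, mem_image] at hg
    rcases hg with (hg | hg) | ⟨g, hg, rfl⟩ | ⟨g, hg, rfl⟩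
    · exact h₁.monotone g hg
    · exact h₂.monotone g hg
    · exact monotone_appendLabel b j (h₃.monotone g hg)
    · exact monotone_prependLabel b (h₄.monotone g hg)
  exists_range_subset A hA hcard := by
    have hlow : {y ∈ A | y < b} ⊆ Ico a b := fun y hy => by
      have := mem_Ico.1 (hA (mem_filter.1 hy).1)
      exact mem_Ico.2 ⟨this.1, (mem_filter.1 hy).2⟩
    have hhigh : {y ∈ A | ¬ y < b} ⊆ Ico b c := fun y hy => by
      have := mem_Ico.1 (hA (mem_filter.1 hy).1)
      exact mem_Ico.2 ⟨not_lt.1 (mem_filter.1 hy).2, this.2⟩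
    have hcases : 2 ^ (j + 1) ≤ #{y ∈ A | y < b} ∨ 2 ^ (j + 1) ≤ #{y ∈ A | ¬ y < b} ∨
        (2 ^ j ≤ #{y ∈ A | y < b} ∧ 0 < #{y ∈ A | ¬ y < b}) ∨
        (0 < #{y ∈ A | y < b} ∧ 2 ^ j ≤ #{y ∈ A | ¬ y < b}) := by
      have hsum := card_filter_add_card_filter_not (s := A) (· < b)
      rw [pow_succ] at hcard ⊢
      omega
    rcases hcases with h | h | ⟨h, h'⟩ | ⟨h', h⟩
    · obtain ⟨g, hg, hgA⟩ := h₁.exists_range_subset _ hlow h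
      exact ⟨g, by simp [hg], hgA.trans (image_subset_image (filter_subset _ _))⟩
    · obtain ⟨g, hg, hgA⟩ := h₂.exists_range_subset _ hhigh h
      exact ⟨g, by simp [hg], hgA.trans (image_subset_image (filter_subset _ _))⟩
    · obtain ⟨g, hg, hgA⟩ := h₃.exists_range_subset _ hlow h
      exact ⟨_, mem_union_right _ (mem_union_left _ (mem_image_of_mem _ hg)),
        range_subset_image_appendLabel hgA (card_pos.1 h')⟩
    · obtain ⟨g, hg, hgA⟩ := h₄.exists_range_subset _ hhigh h
      exact ⟨_, mem_union_right _ (mem_union_right _ (mem_image_of_mem _ hg)),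
        range_subset_image_prependLabel (card_pos.1 h') hgA⟩

theorem exists_isLabellingFamily (m j a : ℕ) :
    ∃ 𝒢, #𝒢 ≤ 4 ^ m ∧ IsLabellingFamily 𝒢 j (Ico a (a + 2 ^ m)) := by
  classical
  induction m generalizing j a with
  | zero =>
    rcases j with _ | j
    · exact ⟨{0}, by simp, isLabellingFamily_zero _⟩
    · exact ⟨∅, by simp, isLabellingFamily_of_card_lt (by simp)⟩
  | succ m ih =>
    rcases j with _ | j
    · exact ⟨{0}, by simpa using Nat.one_le_pow _ _ (by norm_num), isLabellingFamily_zero _⟩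
    obtain ⟨𝒢₁, hcard₁, h₁⟩ := ih (j + 1) a
    obtain ⟨𝒢₂, hcard₂, h₂⟩ := ih (j + 1) (a + 2 ^ m)
    obtain ⟨𝒢₃, hcard₃, h₃⟩ := ih j a
    obtain ⟨𝒢₄, hcard₄, h₄⟩ := ih j (a + 2 ^ m)
    refine ⟨_, ?_, (show a + 2 ^ (m + 1) = a + 2 ^ m + 2 ^ m by ring) ▸
      IsLabellingFamily.bisection h₁ h₂ h₃ h₄⟩
    calc #((𝒢₁ ∪ 𝒢₂) ∪ (𝒢₃.image _ ∪ 𝒢₄.image _))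
        ≤ (#𝒢₁ + #𝒢₂) + (#𝒢₃ + #𝒢₄) :=
          (card_union_le _ _).trans (add_le_add (card_union_le _ _)
            ((card_union_le _ _).trans (add_le_add card_image_le card_image_le)))
      _ ≤ 4 ^ (m + 1) := by rw [pow_succ]; omega

end Bisection

section MarcusTardos

/-- The index of the `s × s` block which contains the position `p`. -/
def blockIndex (s : ℕ) (p : ℕ × ℕ) : ℕ × ℕ := (p.1 / s, p.2 / s)

/-- The entries of `S` in the `s × s` block with index `q`. -/
def block (S : Finset (ℕ × ℕ)) (s : ℕ) (q : ℕ × ℕ) : Finset (ℕ × ℕ) :=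
  {p ∈ S | blockIndex s p = q}

/-- The indices of the blocks with entries of `S` in at least `w` columns. -/
def wideBlocks (S : Finset (ℕ × ℕ)) (s w : ℕ) : Finset (ℕ × ℕ) :=
  {q ∈ S.image (blockIndex s) | w ≤ #((block S s q).image Prod.snd)}

theorem mem_block {S : Finset (ℕ × ℕ)} {s : ℕ} {p q : ℕ × ℕ} :
    p ∈ block S s q ↔ p ∈ S ∧ blockIndex s p = q := mem_filter

theorem mem_wideBlocks {S : Finset (ℕ × ℕ)} {s w : ℕ} {q : ℕ × ℕ} :
    q ∈ wideBlocks S s w ↔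
      q ∈ S.image (blockIndex s) ∧ w ≤ #((block S s q).image Prod.snd) := mem_filter

theorem mem_Ico_mul_div (x : ℕ) {s : ℕ} (hs : 0 < s) : x ∈ Ico (s * (x / s)) (s * (x / s) + s) :=
  mem_Ico.2 ⟨Nat.mul_div_le x s, by simpa [mul_add] using Nat.lt_mul_div_succ x hs⟩

theorem card_wideBlocks_filter_snd_le {S : Finset (ℕ × ℕ)} {k : ℕ}
    (hS : ¬ HasGridMinor (fun x y => (x, y) ∈ S) (k + 1)) (m c : ℕ) :
    #{q ∈ wideBlocks S (2 ^ m) (2 ^ k) | q.2 = c} ≤ (k + 1) * 4 ^ m := by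
  classical
  set Q := {q ∈ wideBlocks S (2 ^ m) (2 ^ k) | q.2 = c} with hQ
  by_contra! hcard
  obtain ⟨𝒢, h𝒢, hfam⟩ := exists_isLabellingFamily m k (2 ^ m * c)
  have hlabel (q) (hq : q ∈ Q) :
      ∃ g ∈ 𝒢, range (k + 1) ⊆ ((block S (2 ^ m) q).image Prod.snd).image g := by
    obtain ⟨hqW, rfl⟩ := mem_filter.1 hq
    refine hfam.exists_range_subset _ (fun y hy => ?_) (mem_wideBlocks.1 hqW).2
    obtain ⟨p, hp, rfl⟩ := mem_image.1 hy
    obtain ⟨-, rfl⟩ := mem_block.1 hp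
    exact mem_Ico_mul_div p.2 (by positivity)
  choose! lab hlab hlab' using hlabel
  obtain ⟨g, hg, hfib⟩ : ∃ g ∈ 𝒢, k + 1 ≤ #{q ∈ Q | lab q = g} := by
    refine exists_le_card_fiber_of_mul_le_card_of_maps_to hlab ?_ ?_
    · obtain ⟨q, hq⟩ : Q.Nonempty := card_pos.1 (by omega)
      exact ⟨lab q, hlab q hq⟩
    · nlinarith
  refine hS (hasGridMinor_of_common_labelling (π := (· / 2 ^ m)) (g := g)
    (J := {q ∈ Q | lab q = g}.image Prod.fst) (fun _ _ => Nat.div_le_div_right)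
    (hfam.monotone g hg) ?_ ?_)
  · rwa [card_image_of_injOn]
    have hsnd (q) (hq : q ∈ {q ∈ Q | lab q = g}) : q.2 = c :=
      (mem_filter.1 (mem_filter.1 hq).1).2
    exact fun q hq q' hq' h => Prod.ext h ((hsnd q hq).trans (hsnd q' hq').symm)
  · intro a ha b hb
    obtain ⟨q, hq, rfl⟩ := mem_image.1 ha
    obtain ⟨hqQ, rfl⟩ := mem_filter.1 hq
    obtain ⟨y, hy, hyb⟩ := mem_image.1 (hlab' q hqQ (mem_range.2 hb))
    obtain ⟨p, hp, rfl⟩ := mem_image.1 hy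
    obtain ⟨hpS, rfl⟩ := mem_block.1 hp
    exact ⟨p.1, p.2, hpS, rfl, hyb⟩

theorem card_wideBlocks_le {S : Finset (ℕ × ℕ)} {k m n : ℕ}
    (hS : ¬ HasGridMinor (fun x y => (x, y) ∈ S) (k + 1)) (hn : ∀ p ∈ S, p.2 / 2 ^ m < n) :
    #(wideBlocks S (2 ^ m) (2 ^ k)) ≤ (k + 1) * 4 ^ m * n := by
  rw [← card_range n]
  refine card_le_mul_card_image_of_maps_to (f := Prod.snd) (fun q hq => ?_) _
    fun c _ => card_wideBlocks_filter_snd_le hS m c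
  obtain ⟨p, hp, rfl⟩ := mem_image.1 (mem_wideBlocks.1 hq).1
  exact mem_range.2 (hn p hp)

theorem not_hasGridMinor_image_swap {S : Finset (ℕ × ℕ)} {k : ℕ}
    (hS : ¬ HasGridMinor (fun x y => (x, y) ∈ S) k) :
    ¬ HasGridMinor (fun x y => (x, y) ∈ S.image Prod.swap) k :=
  fun h => hS <| by simpa using h.swap

theorem card_le_card_image_mul_card_image {α β : Type*} [DecidableEq α] [DecidableEq β]
    (F : Finset (α × β)) :
    #F ≤ #(F.image Prod.fst) * #(F.image Prod.snd) := by
  rw [← card_product]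
  exact card_le_card subset_product

theorem block_image_swap (S : Finset (ℕ × ℕ)) (s : ℕ) (q : ℕ × ℕ) :
    block (S.image Prod.swap) s q.swap = (block S s q).image Prod.swap := by
  ext ⟨x, y⟩
  simp [mem_block, blockIndex, Prod.ext_iff, and_comm]

theorem card_block_le_sq (S : Finset (ℕ × ℕ)) {s : ℕ} (hs : 0 < s) (q : ℕ × ℕ) :
    #(block S s q) ≤ s * s := by
  have : block S s q ⊆ Ico (s * q.1) (s * q.1 + s) ×ˢ Ico (s * q.2) (s * q.2 + s) := by
    intro p hp
    obtain ⟨-, rfl⟩ := mem_block.1 hp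
    exact mem_product.2 ⟨mem_Ico_mul_div p.1 hs, mem_Ico_mul_div p.2 hs⟩
  simpa using card_le_card this

theorem card_block_le_of_notMem_wideBlocks {S : Finset (ℕ × ℕ)} {s w : ℕ} {q : ℕ × ℕ}
    (hq : q ∈ S.image (blockIndex s)) (hwide : q ∉ wideBlocks S s w)
    (htall : q.swap ∉ wideBlocks (S.image Prod.swap) s w) : #(block S s q) ≤ w * w := by
  have hsnd : #((block S s q).image Prod.snd) ≤ w := by
    by_contra! h
    exact hwide (mem_wideBlocks.2 ⟨hq, h.le⟩)
  have hfst : #((block S s q).image Prod.fst) ≤ w := by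
    by_contra! h
    refine htall (mem_wideBlocks.2 ⟨?_, ?_⟩)
    · obtain ⟨p, hp, rfl⟩ := mem_image.1 hq
      exact mem_image.2 ⟨p.swap, mem_image_of_mem _ hp, rfl⟩
    · rw [block_image_swap, image_image]
      exact h.le
  exact (card_le_card_image_mul_card_image _).trans (Nat.mul_le_mul hfst hsnd)

/-- Blocks which are neither wide nor tall have at most `w * w` entries. -/
theorem card_le_card_blocks (S : Finset (ℕ × ℕ)) {s : ℕ} (hs : 0 < s) (w : ℕ) :
    #S ≤ #(S.image (blockIndex s)) * (w * w) +
      (#(wideBlocks S s w) + #(wideBlocks (S.image Prod.swap) s w)) * (s * s) := by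
  set W := wideBlocks S s w ∪ (wideBlocks (S.image Prod.swap) s w).image Prod.swap with hW
  have hsplit : S ⊆ ((S.image (blockIndex s)) \ W).biUnion (block S s) ∪ W.biUnion (block S s) := by
    rw [← union_biUnion]
    exact fun p hp => mem_biUnion.2
      ⟨_, by simpa using Or.inl ⟨_, _, hp, rfl⟩, mem_block.2 ⟨hp, rfl⟩⟩
  have hsmall : #(((S.image (blockIndex s)) \ W).biUnion (block S s)) ≤
      #(S.image (blockIndex s)) * (w * w) := by
    refine (card_biUnion_le_card_mul _ _ (w * w) fun q hq => ?_).trans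
      (Nat.mul_le_mul_right _ (card_le_card sdiff_subset))
    simp only [hW, mem_sdiff, mem_union, not_or] at hq
    exact card_block_le_of_notMem_wideBlocks hq.1 hq.2.1
      fun h => hq.2.2 (mem_image.2 ⟨_, h, Prod.swap_swap q⟩)
  have hbig : #(W.biUnion (block S s)) ≤ #W * (s * s) :=
    card_biUnion_le_card_mul _ _ _ fun q _ => card_block_le_sq S hs q
  have hWcard : #W ≤ #(wideBlocks S s w) + #(wideBlocks (S.image Prod.swap) s w) :=
    (card_union_le _ _).trans (Nat.add_le_add_left card_image_le _)
  calc #S ≤ _ := (card_le_card hsplit).trans (card_union_le _ _)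
    _ ≤ #(S.image (blockIndex s)) * (w * w) + #W * (s * s) := Nat.add_le_add hsmall hbig
    _ ≤ _ := Nat.add_le_add_left (Nat.mul_le_mul_right _ hWcard) _

/-- The constant of the Marcus–Tardos theorem obtained from blocks of side `2 ^ (2 * k + 2)`. -/
def gridConst (k : ℕ) : ℕ := 8 * ((k + 1) * 4 ^ (2 * k + 2)) * 2 ^ (2 * k + 2)

theorem gridConst_pos (k : ℕ) : 0 < gridConst k := by
  unfold gridConst
  positivity

/-- The Marcus–Tardos theorem. -/
theorem card_le_of_not_hasGridMinor {k n : ℕ} {S : Finset (ℕ × ℕ)}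
    (hSn : S ⊆ range n ×ˢ range n) (hS : ¬ HasGridMinor (fun x y => (x, y) ∈ S) (k + 1)) :
    #S ≤ gridConst k * n := by
  induction n using Nat.strong_induction_on generalizing S with
  | _ n ih =>
  set s := 2 ^ (2 * k + 2) with hs
  set N := (k + 1) * 4 ^ (2 * k + 2)
  have hs0 : 0 < s := by positivity
  have hs4 : s = 4 * (2 ^ k * 2 ^ k) := by rw [hs]; ring
  have hN0 : 0 < N := by positivity
  have hw0 : 0 < 2 ^ k * 2 ^ k := by positivity
  have hC : gridConst k = 8 * N * s := rfl
  rcases Nat.lt_or_ge n s with hn | hn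
  · calc #S ≤ n * n := by simpa using card_le_card hSn
      _ ≤ gridConst k * n := Nat.mul_le_mul_right n (by rw [hC]; nlinarith)
  set n' := (n - 1) / s + 1 with hn'
  have hsn' : s * n' ≤ 2 * n := by
    have := Nat.mul_div_le (n - 1) s
    rw [hn', mul_add, mul_one]
    omega
  have hdiv (x) (hx : x < n) : x / s < n' :=
    Nat.lt_succ_iff.2 (Nat.div_le_div_right (by omega))
  have hSn' (p) (hp : p ∈ S) : p.1 < n ∧ p.2 < n := by simpa using hSn hp
  have hblocks : #(S.image (blockIndex s)) ≤ gridConst k * n' := by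
    refine ih n' (by nlinarith) ?_ fun h =>
      hS (h.of_contraction (π := (· / s)) (ρ := (· / s)) ?_ ?_ ?_)
    · intro q hq
      obtain ⟨p, hp, rfl⟩ := mem_image.1 hq
      simpa [blockIndex] using ⟨hdiv _ (hSn' p hp).1, hdiv _ (hSn' p hp).2⟩
    · exact fun _ _ => Nat.div_le_div_right
    · exact fun _ _ => Nat.div_le_div_right
    · simp [blockIndex]
  have hwide : #(wideBlocks S s (2 ^ k)) ≤ N * n' :=
    card_wideBlocks_le hS fun p hp => hdiv _ (hSn' p hp).2
  have htall : #(wideBlocks (S.image Prod.swap) s (2 ^ k)) ≤ N * n' := by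
    refine card_wideBlocks_le (not_hasGridMinor_image_swap hS) fun q hq => ?_
    obtain ⟨p, hp, rfl⟩ := mem_image.1 hq
    exact hdiv _ (hSn' p hp).1
  calc #S ≤ _ := card_le_card_blocks S hs0 (2 ^ k)
    _ ≤ gridConst k * n' * (2 ^ k * 2 ^ k) + (N * n' + N * n') * (s * s) := by gcongr
    _ = 4 * N * s * (s * n') := by rw [hC, hs4]; ring
    _ ≤ 4 * N * s * (2 * n) := by gcongr
    _ = gridConst k * n := by rw [hC]; ring

end MarcusTardos

section Homogeneity

variable {V : Type u} {G : SimpleGraph V} {X Y : Finset V}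

theorem Homogeneous.homogeneousTo (h : Homogeneous G X Y) : HomogeneousTo G Y X := fun y hy => by
  simpa [Homogeneous] using
    h.imp (fun h x hx => h x hx y hy) (fun h x hx => h x hx y hy)

theorem Homogeneous.adj_iff_of_singleton {x x' y : V} (h : Homogeneous G X {y}) (hx : x ∈ X)
    (hx' : x' ∈ X) : G.Adj x y ↔ G.Adj x' y := by
  rcases h with h | h <;> simp [h _ hx, h _ hx']

theorem homogeneous_of_homogeneousTo (hYX : HomogeneousTo G Y X) (hXY : HomogeneousTo G X Y) :
    Homogeneous G X Y := by
  by_cases hadj : ∃ x ∈ X, ∃ y ∈ Y, G.Adj x y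
  · obtain ⟨x, hx, y, hy, hxy⟩ := hadj
    refine Or.inl fun x' hx' y' hy' => ?_
    have hx'y : G.Adj x' y := ((hYX y hy).adj_iff_of_singleton hx hx').1 hxy
    exact (((hXY x' hx').adj_iff_of_singleton hy hy').1 hx'y.symm).symm
  · exact Or.inr fun x hx y hy hxy => hadj ⟨x, hx, y, hy, hxy⟩

end Homogeneity

section Merges

variable {V : Type u} [Fintype V] [DecidableEq V] {P Q R : Finpartition (univ : Finset V)}

theorem IsMerge.card_parts (h : IsMerge Q P) : #Q.parts = #P.parts + 1 := by
  obtain ⟨X, hX, Y, hY, hXY, hP⟩ := h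
  have hYX : Y ∈ Q.parts.erase X := mem_erase.2 ⟨hXY.symm, hY⟩
  have hXYmem : X ∪ Y ∉ (Q.parts.erase X).erase Y := fun hmem => by
    obtain ⟨hne, hmem⟩ := mem_erase.1 (mem_of_mem_erase hmem)
    obtain ⟨x, hx⟩ := Q.nonempty_of_mem_parts hX
    exact hne (Q.eq_of_mem_parts hmem hX (mem_union_left _ hx) hx)
  rw [hP, card_insert_of_notMem hXYmem, card_erase_add_one hYX, card_erase_add_one hX]

theorem IsMerge.le (h : IsMerge Q P) : Q ≤ P := by
  obtain ⟨X, -, Y, -, -, hP⟩ := h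
  intro Z hZ
  simp only [hP, mem_insert, mem_erase]
  by_cases hZX : Z = X
  · exact ⟨X ∪ Y, Or.inl rfl, hZX ▸ subset_union_left⟩
  by_cases hZY : Z = Y
  · exact ⟨X ∪ Y, Or.inl rfl, hZY ▸ subset_union_right⟩
  · exact ⟨Z, Or.inr ⟨hZY, hZX, hZ⟩, le_rfl⟩

theorem exists_parts_eq_merge (Q : Finpartition (univ : Finset V)) {X Y : Finset V}
    (hX : X ∈ Q.parts) (hY : Y ∈ Q.parts) :
    ∃ P : Finpartition (univ : Finset V),
      P.parts = insert (X ∪ Y) ((Q.parts.erase X).erase Y) := by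
  set rest := (Q.parts.erase X).erase Y with hrest
  have hdisj : Disjoint (rest.sup id) (X ∪ Y) := by
    refine Finset.disjoint_sup_left.2 fun Z hZ => ?_
    obtain ⟨hZY, hZX, hZ⟩ : Z ≠ Y ∧ Z ≠ X ∧ Z ∈ Q.parts := by simpa [hrest] using hZ
    exact disjoint_union_right.2 ⟨Q.disjoint hZ hX hZX, Q.disjoint hZ hY hZY⟩
  have hsup : rest.sup id ⊔ (X ∪ Y) = univ := by
    refine eq_univ_of_forall fun v => ?_
    obtain ⟨Z, hZ, hvZ⟩ := Q.exists_mem (mem_univ v)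
    simp only [sup_eq_union, mem_union, mem_sup, id]
    by_cases hZX : Z = X
    · exact Or.inr (Or.inl (hZX ▸ hvZ))
    by_cases hZY : Z = Y
    · exact Or.inr (Or.inr (hZY ▸ hvZ))
    · exact Or.inl ⟨Z, mem_erase.2 ⟨hZY, mem_erase.2 ⟨hZX, hZ⟩⟩, hvZ⟩
  have hne : X ∪ Y ≠ ∅ := ((Q.nonempty_of_mem_parts hX).mono subset_union_left).ne_empty
  exact ⟨(Q.ofSubset ((erase_subset _ _).trans (erase_subset _ _)) rfl).extend hne hdisj hsup, rfl⟩

theorem exists_parts_subset_common (hle : R ≤ Q) (hne : R ≠ Q) :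
    ∃ X ∈ R.parts, ∃ Y ∈ R.parts, X ≠ Y ∧ ∃ Z ∈ Q.parts, X ⊆ Z ∧ Y ⊆ Z := by
  by_contra! hsep
  refine hne (le_antisymm hle fun Z hZ => ?_)
  have hsub (v) (hv : v ∈ Z) (X) (hX : X ∈ R.parts) (hvX : v ∈ X) : X ⊆ Z := by
    obtain ⟨Z', hZ', hXZ'⟩ := hle hX
    rwa [Q.eq_of_mem_parts hZ hZ' hv (hXZ' hvX)]
  obtain ⟨z, hz⟩ := Q.nonempty_of_mem_parts hZ
  obtain ⟨X, hX, hzX⟩ := R.exists_mem (mem_univ z)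
  refine ⟨X, hX, fun w hw => ?_⟩
  obtain ⟨Y, hY, hwY⟩ := R.exists_mem (mem_univ w)
  have hXY : X = Y := by
    by_contra hXY
    exact hsep X hX Y hY hXY Z hZ (hsub z hz X hX hzX) (hsub w hw Y hY hwY)
  exact hXY ▸ hwY

theorem exists_isMerge_le (hle : R ≤ Q) (hne : R ≠ Q) : ∃ R', IsMerge R R' ∧ R' ≤ Q := by
  obtain ⟨X, hX, Y, hY, hXY, Z, hZ, hXZ, hYZ⟩ := exists_parts_subset_common hle hne
  obtain ⟨R', hR'⟩ := exists_parts_eq_merge R hX hY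
  refine ⟨R', ⟨X, hX, Y, hY, hXY, hR'⟩, fun W hW => ?_⟩
  rcases mem_insert.1 (hR' ▸ hW) with rfl | hW
  · exact ⟨Z, hZ, union_subset hXZ hYZ⟩
  · exact hle (mem_of_mem_erase (mem_of_mem_erase hW))

theorem exists_merge_chain (h : P ≤ Q) :
    Relation.ReflTransGen (fun A B => IsMerge A B ∧ P ≤ B ∧ B ≤ Q) P Q := by
  suffices hchain : ∀ R, P ≤ R → R ≤ Q →
      Relation.ReflTransGen (fun A B => IsMerge A B ∧ P ≤ B ∧ B ≤ Q) R Q from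
    hchain P le_rfl h
  intro R hPR hRQ
  induction hc : #R.parts using Nat.strong_induction_on generalizing R with
  | _ c ih =>
    rcases eq_or_ne R Q with rfl | hne
    · exact .refl
    obtain ⟨R', hm, hR'Q⟩ := exists_isMerge_le hRQ hne
    have hcard := hm.card_parts
    have hPR' := hPR.trans hm.le
    exact .head ⟨hm, hPR', hR'Q⟩ (ih #R'.parts (by omega) R' hPR' hR'Q rfl)

theorem exists_merge_sequence {p : Finpartition (univ : Finset V) → Prop}
    {T : Finpartition (univ : Finset V)} (hT : #T.parts = 1)
    (h : Relation.ReflTransGen (fun A B => IsMerge A B ∧ p B) Q T) :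
    ∃ part : ℕ → Finpartition (univ : Finset V),
      1 ≤ #Q.parts ∧ part #Q.parts = Q ∧ part 1 = T ∧
      ∀ i, 1 ≤ i → i < #Q.parts → IsMerge (part (i + 1)) (part i) ∧ p (part i) := by
  induction h using Relation.ReflTransGen.head_induction_on with
  | refl => exact ⟨fun _ => T, hT.ge, rfl, rfl, fun i hi hi' => by omega⟩
  | @head A B hAB _ ih =>
    obtain ⟨part, hpos, hB, hone, hpart⟩ := ih
    have hcard := hAB.1.card_parts
    refine ⟨Function.update part #A.parts A, by omega, Function.update_self .., ?_, ?_⟩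
    · rw [Function.update_of_ne (by omega), hone]
    · intro i hi hi'
      rw [Function.update_of_ne hi'.ne]
      rcases (Nat.lt_succ_iff.1 (hcard ▸ hi')).lt_or_eq with hlt | rfl
      · rw [Function.update_of_ne (by omega)]
        exact hpart i hi hlt
      · rw [← hcard, Function.update_self, hB]
        exact hAB

theorem exists_partitionSequence_of_chain {p : Finpartition (univ : Finset V) → Prop}
    {T : Finpartition (univ : Finset V)} (hT : T.parts = {univ}) (hbot : p ⊥)
    (h : Relation.ReflTransGen (fun A B => IsMerge A B ∧ p B) ⊥ T) :
    ∃ S : PartitionSequence V, ∀ i, 1 ≤ i → i ≤ Fintype.card V → p (S.part i) := by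
  obtain ⟨part, -, hfinest, hcoarsest, hpart⟩ := exists_merge_sequence (by simp [hT]) h
  rw [Finpartition.card_bot, card_univ] at hfinest hpart
  refine ⟨⟨part, hfinest, hcoarsest ▸ hT, fun i hi hi' => (hpart i hi hi').1⟩, fun i hi hi' => ?_⟩
  rcases hi'.lt_or_eq with hlt | rfl
  · exact (hpart i hi hlt).2
  · simpa only [hfinest] using hbot

theorem nonempty_partitionSequence [Nonempty V] : Nonempty (PartitionSequence V) := by
  obtain ⟨S, -⟩ := exists_partitionSequence_of_chain (p := fun _ => True)
    (T := .indiscrete (univ_nonempty (α := V)).ne_empty) rfl trivial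
    (Relation.ReflTransGen.mono (fun _ _ h => ⟨h.1, trivial⟩) _ _ (exists_merge_chain bot_le))
  exact ⟨S⟩

end Merges

section Width

variable {V : Type u} [Fintype V] [DecidableEq V] {G : SimpleGraph V}
  {P : Finpartition (univ : Finset V)}

theorem partitionWidth_le {w : SimpleGraph V → Finpartition (univ : Finset V) → ℕ} {t : ℕ}
    (S : PartitionSequence V) (hS : ∀ i, 1 ≤ i → i ≤ Fintype.card V → w G (S.part i) ≤ t) :
    partitionWidth w G ≤ t :=
  Nat.sInf_le ⟨S, hS⟩

theorem exists_sequence_le_partitionWidth [Nonempty V]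
    (w : SimpleGraph V → Finpartition (univ : Finset V) → ℕ) (G : SimpleGraph V) :
    ∃ S : PartitionSequence V, ∀ i, 1 ≤ i → i ≤ Fintype.card V →
      w G (S.part i) ≤ partitionWidth w G := by
  obtain ⟨S⟩ := nonempty_partitionSequence (V := V)
  exact Nat.sInf_mem (s := {t | ∃ S : PartitionSequence V, ∀ i, 1 ≤ i → i ≤ Fintype.card V →
    w G (S.part i) ≤ t}) ⟨(range (Fintype.card V + 1)).sup fun i => w G (S.part i), S,
      fun i _ hi => le_sup (f := fun i => w G (S.part i)) (mem_range.2 (Nat.lt_succ_of_le hi))⟩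

theorem redOutDegreeWidth_le_redDegreeWidth (G : SimpleGraph V)
    (P : Finpartition (univ : Finset V)) : redOutDegreeWidth G P ≤ redDegreeWidth G P := by
  classical
  exact sup_mono_fun fun X _ => card_le_card <| monotone_filter_right _
    fun Y _ hXY => ⟨hXY.1, fun h => hXY.2 h.homogeneousTo⟩

theorem redDegreeWidth_eq_zero (h : ∀ X ∈ P.parts, ∀ Y ∈ P.parts, ¬ RedEdge G X Y) :
    redDegreeWidth G P = 0 := by
  classical
  refine Nat.le_zero.1 (Finset.sup_le fun X hX => ?_)
  rw [Nat.le_zero, card_eq_zero, filter_eq_empty_iff]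
  exact fun Y hY => h X hX Y hY

open Classical in
theorem card_redArc_le_redOutDegreeWidth (G : SimpleGraph V) {X : Finset V} (hX : X ∈ P.parts) :
    #{Y ∈ P.parts | RedArc G X Y} ≤ redOutDegreeWidth G P :=
  le_sup (f := fun X => #{Y ∈ P.parts | RedArc G X Y}) hX

theorem redDegreeWidth_eq_zero_of_redOutDegreeWidth_eq_zero (h : redOutDegreeWidth G P = 0) :
    redDegreeWidth G P = 0 := by
  classical
  have hhom (X) (hX : X ∈ P.parts) (Y) (hY : Y ∈ P.parts) (hXY : X ≠ Y) : HomogeneousTo G Y X := by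
    have hcard := (card_redArc_le_redOutDegreeWidth G hX).trans h.le
    rw [Nat.le_zero, card_eq_zero, filter_eq_empty_iff] at hcard
    by_contra hred
    exact hcard hY ⟨hXY, hred⟩
  exact redDegreeWidth_eq_zero fun X hX Y hY hred => hred.2
    (homogeneous_of_homogeneousTo (hhom X hX Y hY hred.1) (hhom Y hY X hX hred.1.symm))

theorem redDegreeWidth_bot (G : SimpleGraph V) : redDegreeWidth G ⊥ = 0 := by
  refine redDegreeWidth_eq_zero fun X hX Y hY hred => hred.2 ?_
  obtain ⟨x, -, rfl⟩ := Finpartition.mem_bot_iff.1 hX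
  obtain ⟨y, -, rfl⟩ := Finpartition.mem_bot_iff.1 hY
  simpa [Homogeneous] using em (G.Adj x y)

theorem otww_le_tww [Nonempty V] (G : SimpleGraph V) : otww V G ≤ tww V G := by
  obtain ⟨S, hS⟩ := exists_sequence_le_partitionWidth redDegreeWidth G
  exact partitionWidth_le S fun i hi hi' =>
    (redOutDegreeWidth_le_redDegreeWidth G _).trans (hS i hi hi')

theorem tww_eq_zero_of_otww_eq_zero [Nonempty V] (h : otww V G = 0) : tww V G = 0 := by
  obtain ⟨S, hS⟩ := exists_sequence_le_partitionWidth redOutDegreeWidth G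
  exact Nat.le_zero.1 <| partitionWidth_le S fun i hi hi' =>
    (redDegreeWidth_eq_zero_of_redOutDegreeWidth_eq_zero
      (Nat.le_zero.1 ((hS i hi hi').trans h.le))).le

end Width

section Corners

variable {n m : ℕ} {α : Type*} {M : Matrix (Fin n) (Fin m) α} {R R' : Finset (Fin n)}
  {C C' : Finset (Fin m)}

theorem IsMixed.mono (hR : R ⊆ R') (hC : C ⊆ C') (h : IsMixed M R C) : IsMixed M R' C' :=
  ⟨fun hv => h.1 fun i hi i' hi' j hj => hv i (hR hi) i' (hR hi') j (hC hj),
    fun hh => h.2 fun i hi j hj j' hj' => hh i (hR hi) j (hC hj) j' (hC hj')⟩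

theorem isMixed_transpose : IsMixed M.transpose C R ↔ IsMixed M R C := by
  have hv : IsVertical M.transpose C R ↔ IsHorizontal M R C :=
    ⟨fun h i hi j hj j' hj' => h j hj j' hj' i hi, fun h j hj j' hj' i hi => h i hi j hj j' hj'⟩
  have hh : IsHorizontal M.transpose C R ↔ IsVertical M R C :=
    ⟨fun h i hi i' hi' j hj => h j hj i hi i' hi', fun h j hj i hi i' hi' => h i hi i' hi' j hj⟩
  rw [IsMixed, IsMixed, hv, hh, and_comm]

theorem not_isMixed_pair {i i' : Fin n} {j j' : Fin m} :
    ¬ IsMixed M {i, i'} {j, j'} ↔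
      (M i j = M i' j ∧ M i j' = M i' j') ∨ (M i j = M i j' ∧ M i' j = M i' j') := by
  have hv : IsVertical M {i, i'} {j, j'} ↔ M i j = M i' j ∧ M i j' = M i' j' := by
    simp [IsVertical, eq_comm (a := M i' j), eq_comm (a := M i' j')]
  have hh : IsHorizontal M {i, i'} {j, j'} ↔ M i j = M i j' ∧ M i' j = M i' j' := by
    simp [IsHorizontal, eq_comm (a := M i j'), eq_comm (a := M i' j')]
  rw [IsMixed, hv, hh, ← not_or, not_not]

/-- A corner: the contiguous `2 × 2` submatrix with top left entry `(i, j)` is mixed. In the last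
row or column, where `Order.succ` is the identity, there are no corners. -/
def IsCorner (M : Matrix (Fin n) (Fin m) α) (i : Fin n) (j : Fin m) : Prop :=
  IsMixed M {i, Order.succ i} {j, Order.succ j}

theorem IsCorner.lt_succ_left {i : Fin n} {j : Fin m} (h : IsCorner M i j) :
    i < Order.succ i := by
  refine (Order.le_succ i).lt_of_ne fun hi => not_isMixed_pair.2 (Or.inl ?_) h
  simp [← hi]

theorem IsCorner.transpose {i : Fin n} {j : Fin m} (h : IsCorner M i j) :
    IsCorner M.transpose j i := isMixed_transpose.2 h

theorem eq_of_forall_eq_succ {ι β : Type*} [LinearOrder ι] [SuccOrder ι]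
    [IsSuccArchimedean ι] {s : Set ι} (hs : s.OrdConnected) {f : ι → β}
    (h : ∀ i ∈ s, Order.succ i ∈ s → f i = f (Order.succ i)) {a b : ι} (ha : a ∈ s)
    (hb : b ∈ s) : f a = f b := by
  wlog hab : a ≤ b generalizing a b
  · exact (this hb ha (le_of_not_ge hab)).symm
  induction hab using Succ.rec with
  | rfl => rfl
  | succ c hac ih =>
    have hc : c ∈ s := hs.out ha hb ⟨hac, Order.le_succ c⟩
    exact (ih hc).trans (h c hc hb)

/-- If some two horizontally adjacent entries differ then, as there are no corners, so do those of
every other row in the same two columns; this makes adjacent rows agree there, and then everywhere.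
-/
theorem IsMixed.exists_isCorner (hR : (R : Set (Fin n)).OrdConnected)
    (hC : (C : Set (Fin m)).OrdConnected) (h : IsMixed M R C) :
    ∃ i j, i ∈ R ∧ Order.succ i ∈ R ∧ j ∈ C ∧ Order.succ j ∈ C ∧ IsCorner M i j := by
  by_contra! hfree
  have hzone {i j} (hi : i ∈ R) (hi' : Order.succ i ∈ R) (hj : j ∈ C) (hj' : Order.succ j ∈ C) :=
    not_isMixed_pair.1 (hfree i j hi hi' hj hj')
  obtain ⟨i₀, hi₀, j₀, hj₀, hj₀', hne⟩ :
      ∃ i ∈ R, ∃ j ∈ C, Order.succ j ∈ C ∧ M i j ≠ M i (Order.succ j) := by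
    by_contra! hconst
    exact h.2 fun i hi j hj j' hj' => eq_of_forall_eq_succ hC (hconst i hi) hj hj'
  have hrow : ∀ i ∈ R, M i j₀ ≠ M i (Order.succ j₀) := by
    intro i hi
    refine (eq_of_forall_eq_succ hR (f := fun i => M i j₀ ≠ M i (Order.succ j₀))
      (fun q hq hq' => ?_) hi₀ hi).mp hne
    rcases hzone hq hq' hj₀ hj₀' with ⟨e, e'⟩ | ⟨e, e'⟩ <;> simp [e, e']
  have hcol : ∀ q ∈ R, Order.succ q ∈ R → ∀ j ∈ C, M q j = M (Order.succ q) j := by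
    intro q hq hq' j hj
    have h₀ : M q j₀ = M (Order.succ q) j₀ :=
      (hzone hq hq' hj₀ hj₀').elim And.left fun e => absurd e.1 (hrow q hq)
    refine (eq_of_forall_eq_succ hC (f := fun j => M q j = M (Order.succ q) j)
      (fun p hp hp' => ?_) hj₀ hj).mp h₀
    rcases hzone hq hq' hp hp' with ⟨e, e'⟩ | ⟨e, e'⟩ <;> simp [e, e']
  exact h.1 fun i hi i' hi' j hj =>
    eq_of_forall_eq_succ hR (f := fun i => M i j) (fun q hq hq' => hcol q hq hq' j hj) hi hi'

theorem exists_division_of_monotone {t : ℕ} {f : Fin n → ℕ} (hf : Monotone f)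
    (himage : univ.image f = range t) :
    ∃ P : Finpartition (univ : Finset (Fin n)), IsDivision P ∧ #P.parts = t ∧
      ∀ X ∈ P.parts, ∃ a < t, X = ({i | f i = a} : Finset (Fin n)) := by
  classical
  have hmem (X : Finset (Fin n)) : X ∈ (Finpartition.ofSetoid (Setoid.ker f)).parts ↔
      X ∈ (univ.image f).image fun a => ({i | f i = a} : Finset (Fin n)) := by
    simp [Finpartition.ofSetoid, Finpartition.ofSetSetoid, Setoid.ker_def, eq_comm]
  have hparts (X) (hX : X ∈ (Finpartition.ofSetoid (Setoid.ker f)).parts) :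
      ∃ a < t, X = ({i | f i = a} : Finset (Fin n)) := by
    rw [hmem, himage] at hX
    simpa [eq_comm] using hX
  refine ⟨.ofSetoid (Setoid.ker f), fun X hX => ?_, ?_, hparts⟩
  · obtain ⟨a, -, rfl⟩ := hparts X hX
    simpa [Set.preimage] using (Set.ordConnected_singleton (a := a)).preimage_mono hf
  · rw [Finset.ext hmem, card_image_of_injOn, himage, card_range]
    intro a ha b _ hab
    obtain ⟨i, -, rfl⟩ := mem_image.1 (mem_coe.1 ha)
    simpa using congrArg (i ∈ ·) hab

theorem exists_division_of_pairs_of_labels {t : ℕ} (ht : 0 < t) {f : Fin n → ℕ} (hf : Monotone f)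
    (hsurj : ∀ a < 2 * t, ∃ i, f i = a) :
    ∃ P : Finpartition (univ : Finset (Fin n)), IsDivision P ∧ #P.parts = t ∧
      ∀ X ∈ P.parts, ∃ a < t, ∀ i i', f i = 2 * a → f i' = 2 * a + 1 → {i, Order.succ i} ⊆ X := by
  have himage : univ.image (fun i => min (f i / 2) (t - 1)) = range t := by
    ext a
    simp only [mem_image, mem_univ, true_and, mem_range]
    refine ⟨fun ⟨i, hi⟩ => by omega, fun ha => ?_⟩
    obtain ⟨i, hi⟩ := hsurj (2 * a) (by omega)
    exact ⟨i, by omega⟩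
  obtain ⟨P, hP, hcard, hparts⟩ := exists_division_of_monotone
    (fun x y hxy => min_le_min_right _ (Nat.div_le_div_right (hf hxy))) himage
  refine ⟨P, hP, hcard, fun X hX => ?_⟩
  obtain ⟨a, ha, rfl⟩ := hparts X hX
  refine ⟨a, ha, fun i i' hi hi' => ?_⟩
  have hsucc : f (Order.succ i) ≤ 2 * a + 1 :=
    hi' ▸ hf (Order.succ_le_of_lt (hf.reflect_lt (by omega)))
  have := hf (Order.le_succ i)
  simp only [insert_subset_iff, singleton_subset_iff, mem_filter_univ]
  omega

/-- Merging the labels in pairs keeps the corner with label `(2a, 2b)` within one zone. -/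
theorem hasMixedMinor_of_hasGridMinor_isCorner {t : ℕ} (ht : 0 < t)
    (h : HasGridMinor (IsCorner M) (2 * t)) : HasMixedMinor M t := by
  obtain ⟨f, g, hf, hg, hfg⟩ := h
  obtain ⟨R, hR, hRt, hRf⟩ := exists_division_of_pairs_of_labels ht hf fun a ha => by
    obtain ⟨i, -, -, hi, -⟩ := hfg a ha 0 (by omega)
    exact ⟨i, hi⟩
  obtain ⟨C, hC, hCt, hCg⟩ := exists_division_of_pairs_of_labels ht hg fun b hb => by
    obtain ⟨-, j, -, -, hj⟩ := hfg 0 (by omega) b hb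
    exact ⟨j, hj⟩
  refine ⟨R, C, hR, hC, hRt, hCt, fun X hX Y hY => ?_⟩
  obtain ⟨a, ha, hXa⟩ := hRf X hX
  obtain ⟨b, hb, hYb⟩ := hCg Y hY
  obtain ⟨i, j, hij, hi, hj⟩ := hfg (2 * a) (by omega) (2 * b) (by omega)
  obtain ⟨i', j', -, hi', hj'⟩ := hfg (2 * a + 1) (by omega) (2 * b + 1) (by omega)
  exact IsMixed.mono (hXa i i' hi hi') (hYb j j' hj hj') hij

end Corners

section MergedLabels

/-- The relabelling that identifies the labels `c` and `c + 1`. -/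
def mergeLabel (c x : ℕ) : ℕ := if x ≤ c then x else x - 1

theorem monotone_mergeLabel (c : ℕ) : Monotone (mergeLabel c) := by
  intro x y hxy
  unfold mergeLabel
  split_ifs <;> omega

theorem mergeLabel_lt {c p x : ℕ} (hc : c < p) (hx : x < p + 1) : mergeLabel c x < p := by
  unfold mergeLabel
  split_ifs <;> omega

theorem mergeLabel_eq_self_iff {c x : ℕ} : mergeLabel c x = c ↔ x = c ∨ x = c + 1 := by
  unfold mergeLabel
  split_ifs <;> omega

theorem exists_eq_of_mergeLabel_eq {c a : ℕ} (ha : a ≠ c) :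
    ∃ a', ∀ x, mergeLabel c x = a → x = a' := by
  refine ⟨if a < c then a else a + 1, fun x hx => ?_⟩
  unfold mergeLabel at hx
  split_ifs at hx ⊢ <;> omega

theorem card_filter_mergeLabel_mem_le (c : ℕ) (s L : Finset ℕ) :
    #{x ∈ s | mergeLabel c x ∈ L} ≤ 2 * #L := by
  refine card_le_mul_card_image_of_maps_to (f := mergeLabel c)
    (fun x hx => (mem_filter.1 hx).2) 2 fun b _ => ?_
  have : {x ∈ {x ∈ s | mergeLabel c x ∈ L} | mergeLabel c x = b} ⊆ {b, b + 1} := by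
    intro x hx
    have h := (mem_filter.1 hx).2
    unfold mergeLabel at h
    simp only [mem_insert, mem_singleton]
    split_ifs at h <;> omega
  exact (card_le_card this).trans card_le_two

theorem exists_consecutive_add_le {p C : ℕ} (hp : 1 ≤ p) {β : ℕ → ℕ}
    (h : ∑ a ∈ range (p + 1), β a ≤ C * (p + 1)) : ∃ c < p, β c + β (c + 1) ≤ 4 * C := by
  by_contra! hlarge
  have hpairs : p * (4 * C + 1) ≤ ∑ c ∈ range p, β c + ∑ c ∈ range p, β (c + 1) := by
    rw [← sum_add_distrib, ← smul_eq_mul]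
    simpa using card_nsmul_le_sum (range p) (fun c => β c + β (c + 1)) (4 * C + 1)
      fun c hc => hlarge c (mem_range.1 hc)
  have hlast := sum_range_succ β p
  have hfirst := sum_range_succ' β p
  nlinarith

end MergedLabels

section TouchedColumns

variable {ι : Type*} [Preorder ι] {cor : ι → ι → Prop} {δ : ι → ℕ}

open Classical in
/-- The labels less than `p` of the column parts that contain the left column of a corner whose
upper row is labelled `a`; its lower row may have another label. -/
noncomputable def touchedColumns (cor : ι → ι → Prop) (δ : ι → ℕ) (p a : ℕ) : Finset ℕ :=
  {b ∈ range p | ∃ i j, cor i j ∧ δ i = a ∧ δ j = b}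

theorem sum_card_touchedColumns_le {k : ℕ} (hfree : ¬ HasGridMinor cor (k + 1))
    (hδ : Monotone δ) (p : ℕ) :
    ∑ a ∈ range p, #(touchedColumns cor δ p a) ≤ gridConst k * p := by
  classical
  have hsum : ∑ a ∈ range p, #(touchedColumns cor δ p a) =
      #{q ∈ range p ×ˢ range p | ∃ i j, cor i j ∧ δ i = q.1 ∧ δ j = q.2} := by
    simp only [touchedColumns, card_filter, sum_product]
  rw [hsum]
  refine card_le_of_not_hasGridMinor (filter_subset _ _) fun h => hfree ?_
  refine h.of_contraction hδ hδ fun a b hab => ?_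
  exact (mem_filter.1 hab).2

end TouchedColumns

section Divisions

variable {ι : Type*} [LinearOrder ι] [SuccOrder ι] {cor : ι → ι → Prop} {δ : ι → ℕ} {p a b : ℕ}

/-- Some corner lies in the row part `a`, with its left column in the column part `b`. -/
def RowHit (cor : ι → ι → Prop) (δ : ι → ℕ) (a b : ℕ) : Prop :=
  ∃ i j, cor i j ∧ δ i = a ∧ δ (Order.succ i) = a ∧ δ j = b

/-- Some corner lies in the zone formed by the row part `a` and the column part `b`. -/
def ZoneHit (cor : ι → ι → Prop) (δ : ι → ℕ) (a b : ℕ) : Prop :=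
  ∃ i j, cor i j ∧ δ i = a ∧ δ (Order.succ i) = a ∧ δ j = b ∧ δ (Order.succ j) = b

theorem ZoneHit.rowHit (h : ZoneHit cor δ a b) : RowHit cor δ a b := by
  obtain ⟨i, j, h, hi, hi', hj, -⟩ := h
  exact ⟨i, j, h, hi, hi', hj⟩

theorem ZoneHit.swap (hcor : ∀ i j, cor i j → cor j i) (h : ZoneHit cor δ a b) :
    ZoneHit cor δ b a := by
  obtain ⟨i, j, h, hi, hi', hj, hj'⟩ := h
  exact ⟨j, i, hcor i j h, hj, hj', hi, hi'⟩

theorem ZoneHit.comp (μ : ℕ → ℕ) (h : ZoneHit cor δ a b) :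
    ZoneHit cor (μ ∘ δ) (μ a) (μ b) := by
  obtain ⟨i, j, h, hi, hi', hj, hj'⟩ := h
  exact ⟨i, j, h, congrArg μ hi, congrArg μ hi', congrArg μ hj, congrArg μ hj'⟩

open Classical in
/-- The column parts, among those labelled less than `p`, hit in the row part `a`. -/
noncomputable def rowHits (cor : ι → ι → Prop) (δ : ι → ℕ) (p a : ℕ) : Finset ℕ :=
  {b ∈ range p | RowHit cor δ a b}

theorem mem_rowHits : b ∈ rowHits cor δ p a ↔ b < p ∧ RowHit cor δ a b := by
  simp [rowHits]

/-- A division of the rows and the columns into `p` parts, given by the labels of the parts, in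
which every row part has at most `K` hits. -/
structure IsSparseDivision (cor : ι → ι → Prop) (p K : ℕ) (δ : ι → ℕ) : Prop where
  monotone : Monotone δ
  lt : ∀ x, δ x < p
  card_rowHits_le : ∀ a, #(rowHits cor δ p a) ≤ K

/-- By Marcus–Tardos some two consecutive row parts together touch few columns, so they can be
merged. -/
theorem IsSparseDivision.exists_mergeLabel {k : ℕ} (hp : 1 ≤ p)
    (hfree : ¬ HasGridMinor cor (k + 1))
    (h : IsSparseDivision cor (p + 1) (4 * gridConst k) δ) :
    ∃ c, IsSparseDivision cor p (4 * gridConst k) (mergeLabel c ∘ δ) := by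
  obtain ⟨c, hc, hcle⟩ :=
    exists_consecutive_add_le hp (sum_card_touchedColumns_le hfree h.monotone (p + 1))
  refine ⟨c, (monotone_mergeLabel c).comp h.monotone, fun x => mergeLabel_lt hc (h.lt x),
    fun a => ?_⟩
  by_cases hac : a = c
  · subst hac
    have hsub : rowHits cor (mergeLabel a ∘ δ) p a ⊆ (touchedColumns cor δ (p + 1) a ∪
        touchedColumns cor δ (p + 1) (a + 1)).image (mergeLabel a) := by
      intro b hb
      obtain ⟨-, i, j, hij, hi, -, hj⟩ := mem_rowHits.1 hb
      refine mem_image.2 ⟨δ j, ?_, hj⟩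
      simp only [touchedColumns, ← filter_or, mem_filter, mem_range]
      exact ⟨h.lt j, (mergeLabel_eq_self_iff.1 hi).imp (fun hi => ⟨i, j, hij, hi, rfl⟩)
        fun hi => ⟨i, j, hij, hi, rfl⟩⟩
    exact (card_le_card hsub).trans (card_image_le.trans ((card_union_le _ _).trans hcle))
  · obtain ⟨a', ha'⟩ := exists_eq_of_mergeLabel_eq hac
    have hsub : rowHits cor (mergeLabel c ∘ δ) p a ⊆
        (rowHits cor δ (p + 1) a').image (mergeLabel c) := by
      intro b hb
      obtain ⟨-, i, j, hij, hi, hi', hj⟩ := mem_rowHits.1 hb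
      exact mem_image.2
        ⟨δ j, mem_rowHits.2 ⟨h.lt j, i, j, hij, ha' _ hi, ha' _ hi', rfl⟩, hj⟩
    exact (card_le_card hsub).trans (card_image_le.trans (h.card_rowHits_le a'))

/-- Identifies the maximal runs of consecutive column parts not hit in the row part `a`, each hit
part being a run of its own. -/
noncomputable def runKey (cor : ι → ι → Prop) (δ : ι → ℕ) (p a b : ℕ) : ℕ :=
  #{c ∈ rowHits cor δ p a | c < b} + #{c ∈ rowHits cor δ p a | c ≤ b}

theorem runKey_le (cor : ι → ι → Prop) (δ : ι → ℕ) (p a b : ℕ) :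
    runKey cor δ p a b ≤ 2 * #(rowHits cor δ p a) := by
  have hlt := card_filter_le (rowHits cor δ p a) (· < b)
  have hle := card_filter_le (rowHits cor δ p a) (· ≤ b)
  unfold runKey
  omega

theorem notMem_rowHits_of_runKey_eq {b' c : ℕ} (hbb' : b ≠ b')
    (h : runKey cor δ p a b = runKey cor δ p a b') (hc : c ∈ uIcc b b') :
    c ∉ rowHits cor δ p a := by
  wlog hlt : b < b' generalizing b b'
  · exact this hbb'.symm h.symm (uIcc_comm b b' ▸ hc) (by omega)
  intro hmem
  rw [uIcc_of_le hlt.le, mem_Icc] at hc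
  have hltsub : {x ∈ rowHits cor δ p a | x < b} ⊆ {x ∈ rowHits cor δ p a | x < b'} :=
    monotone_filter_right _ fun x _ hx => lt_trans hx hlt
  have hlesub : {x ∈ rowHits cor δ p a | x ≤ b} ⊆ {x ∈ rowHits cor δ p a | x ≤ b'} :=
    monotone_filter_right _ fun x _ hx => le_trans hx hlt.le
  have hltcard := card_le_card hltsub
  have hlecard := card_le_card hlesub
  unfold runKey at h
  have hlteq := eq_of_subset_of_card_le hltsub (by omega)
  have hleeq := eq_of_subset_of_card_le hlesub (by omega)
  have hclt := congrArg (c ∈ ·) hlteq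
  have hcle := congrArg (c ∈ ·) hleeq
  simp only [mem_filter, hmem, true_and, eq_iff_iff] at hclt hcle
  omega

end Divisions

section CornerDivisions

variable {n K p : ℕ} {α : Type*} {M : Matrix (Fin n) (Fin n) α} {δ : Fin n → ℕ}

theorem isSparseDivision_val (M : Matrix (Fin n) (Fin n) α) (K : ℕ) :
    IsSparseDivision (IsCorner M) n K Fin.val where
  monotone := Fin.val_strictMono.monotone
  lt := Fin.is_lt
  card_rowHits_le a := by
    suffices rowHits (IsCorner M) Fin.val n a = ∅ by simp [this]
    refine eq_empty_of_forall_notMem fun b hb => ?_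
    obtain ⟨-, i, j, hij, hi, hi', -⟩ := mem_rowHits.1 hb
    exact hij.lt_succ_left.ne (Fin.ext (hi.trans hi'.symm))

/-- Otherwise the submatrix spanned by the two rows and the two columns is mixed, so it contains a
corner, which hits a column part of the run. -/
theorem eq_or_eq_of_runKey_eq (hδ : Monotone δ) (hlt : ∀ x, δ x < p) {x x' y y' : Fin n}
    (hxx' : δ x = δ x') (hzone : ¬ ZoneHit (IsCorner M) δ (δ x) (δ y))
    (hkey : runKey (IsCorner M) δ p (δ x) (δ y) = runKey (IsCorner M) δ p (δ x) (δ y')) :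
    M x y = M x' y ∨ M x' y = M x' y' := by
  by_contra! hne
  have hmixed : IsMixed M (uIcc x x') (uIcc y y') :=
    ⟨fun h => hne.1 (h x left_mem_uIcc x' right_mem_uIcc y left_mem_uIcc),
      fun h => hne.2 (h x' right_mem_uIcc y left_mem_uIcc y' right_mem_uIcc)⟩
  obtain ⟨i, j, hi, hi', hj, hj', hij⟩ := hmixed.exists_isCorner
    (by simpa using Set.ordConnected_uIcc) (by simpa using Set.ordConnected_uIcc)
  have hmap {u v w : Fin n} (hw : w ∈ uIcc u v) : δ w ∈ uIcc (δ u) (δ v) := by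
    rw [← mem_coe, coe_uIcc] at hw ⊢
    exact hδ.mapsTo_uIcc hw
  have hrow {w : Fin n} (hw : w ∈ uIcc x x') : δ w = δ x := by simpa [← hxx'] using hmap hw
  by_cases hyy' : δ y = δ y'
  · have hcol {w : Fin n} (hw : w ∈ uIcc y y') : δ w = δ y := by simpa [← hyy'] using hmap hw
    exact hzone ⟨i, j, hij, hrow hi, hrow hi', hcol hj, hcol hj'⟩
  · exact notMem_rowHits_of_runKey_eq hyy' hkey (hmap hj)
      (mem_rowHits.2 ⟨hlt j, i, j, hij, hrow hi, hrow hi', rfl⟩)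

end CornerDivisions

section Refinement

variable {V : Type u} {G : SimpleGraph V} {ℓ : V → ℕ} {Z : ℕ → ℕ → Prop}

/-- Two vertices are equivalent if they have the same label and the same neighbors among the
vertices whose label is not related by `Z` to theirs. The labels stand for the parts of a division,
and `Z` for its mixed zones. -/
def refinementSetoid (G : SimpleGraph V) (ℓ : V → ℕ) (Z : ℕ → ℕ → Prop) : Setoid V where
  r u v := ℓ u = ℓ v ∧ ∀ w, ¬ Z (ℓ u) (ℓ w) → (G.Adj u w ↔ G.Adj v w)
  iseqv :=
    { refl := fun _ => ⟨rfl, fun _ _ => Iff.rfl⟩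
      symm := fun h => ⟨h.1.symm, fun w hw => (h.2 w (by rwa [h.1])).symm⟩
      trans := fun h h' => ⟨h.1.trans h'.1, fun w hw =>
        (h.2 w hw).trans (h'.2 w (by rwa [← h.1]))⟩ }

variable [Fintype V] [DecidableEq V] {Q : Finpartition (univ : Finset V)} {X Y : Finset V}
  {u v x y : V}

open Classical in
/-- The refinement of the partition into label classes by neighborhoods outside mixed zones. -/
noncomputable def refinement (G : SimpleGraph V) (ℓ : V → ℕ) (Z : ℕ → ℕ → Prop) :
    Finpartition (univ : Finset V) :=
  .ofSetoid (refinementSetoid G ℓ Z)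

theorem mem_part_refinement : v ∈ (refinement G ℓ Z).part u ↔ refinementSetoid G ℓ Z u v := by
  classical
  exact Finpartition.mem_part_ofSetoid_iff_rel

theorem le_refinement_iff :
    Q ≤ refinement G ℓ Z ↔ ∀ X ∈ Q.parts, ∀ u ∈ X, ∀ v ∈ X, refinementSetoid G ℓ Z u v := by
  constructor
  · intro h X hX u hu v hv
    obtain ⟨Y, hY, hXY⟩ := h hX
    rw [← mem_part_refinement, Finpartition.part_eq_of_mem _ hY (hXY hu)]
    exact hXY hv
  · intro h X hX
    obtain ⟨u, hu⟩ := Q.nonempty_of_mem_parts hX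
    exact ⟨_, (Finpartition.part_mem _).2 (mem_univ u),
      fun v hv => mem_part_refinement.2 (h X hX u hu v hv)⟩

theorem eq_of_refinementSetoid (hQ : refinement G ℓ Z ≤ Q) (hX : X ∈ Q.parts) (hY : Y ∈ Q.parts)
    (hu : u ∈ X) (hv : v ∈ Y) (h : refinementSetoid G ℓ Z u v) : X = Y := by
  obtain ⟨W, hW, hsub⟩ := hQ ((Finpartition.part_mem _).2 (mem_univ u) :
    (refinement G ℓ Z).part u ∈ (refinement G ℓ Z).parts)
  have huW : u ∈ W := hsub ((Finpartition.mem_part_self _).2 (mem_univ u))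
  have hvW : v ∈ W := hsub (mem_part_refinement.2 h)
  rw [Q.eq_of_mem_parts hX hW hu huW, Q.eq_of_mem_parts hY hW hv hvW]

theorem refinement_le_comp {Z' : ℕ → ℕ → Prop} (μ : ℕ → ℕ) (hZ : ∀ a b, Z a b → Z' (μ a) (μ b)) :
    refinement G ℓ Z ≤ refinement G (μ ∘ ℓ) Z' := by
  refine le_refinement_iff.2 fun X hX u hu v hv => ?_
  have h := le_refinement_iff.1 le_rfl X hX u hu v hv
  exact ⟨congrArg μ h.1, fun w hw => h.2 w fun hz => hw (hZ _ _ hz)⟩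

theorem refinement_eq_bot_of_injective (hℓ : Function.Injective ℓ) : refinement G ℓ Z = ⊥ := by
  refine le_antisymm (fun X hX => ?_) bot_le
  obtain ⟨u, hu⟩ := Finpartition.nonempty_of_mem_parts _ hX
  refine ⟨{u}, Finpartition.mem_bot_iff.2 ⟨u, mem_univ u, rfl⟩, fun v hv => ?_⟩
  exact mem_singleton.2 (hℓ (le_refinement_iff.1 le_rfl X hX v hv u hu).1)

theorem homogeneousTo_of_le_refinement (hQ : Q ≤ refinement G ℓ Z) (hX : X ∈ Q.parts)
    (hY : Y ∈ Q.parts) (hx : x ∈ X) (hy : y ∈ Y) (hZ : ¬ Z (ℓ x) (ℓ y)) :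
    HomogeneousTo G Y X := by
  intro y' hy'
  have hlabel : ℓ y = ℓ y' := (le_refinement_iff.1 hQ Y hY y hy y' hy').1
  have hadj {x'} (hx' : x' ∈ X) : G.Adj x y' ↔ G.Adj x' y' :=
    (le_refinement_iff.1 hQ X hX x hx x' hx').2 y' (hlabel ▸ hZ)
  by_cases h : G.Adj x y'
  · exact Or.inl fun x' hx' z hz => by rwa [mem_singleton.1 hz, ← hadj hx']
  · exact Or.inr fun x' hx' z hz => by rwa [mem_singleton.1 hz, ← hadj hx']

theorem rel_of_redEdge (hZ : ∀ a b, Z a b → Z b a) (hQ : Q ≤ refinement G ℓ Z)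
    (hX : X ∈ Q.parts) (hY : Y ∈ Q.parts) (h : RedEdge G X Y) (hx : x ∈ X) (hy : y ∈ Y) :
    Z (ℓ x) (ℓ y) := by
  by_contra hxy
  exact h.2 (homogeneous_of_homogeneousTo (homogeneousTo_of_le_refinement hQ hX hY hx hy hxy)
    (homogeneousTo_of_le_refinement hQ hY hX hy hx fun hyx => hxy (hZ _ _ hyx)))

end Refinement

section OrderedAdjacency

variable {V : Type u} [Fintype V] (G : SimpleGraph V) (σ : Fin (Fintype.card V) ≃ V)

theorem orderedAdj_eq_iff {i j i' j' : Fin (Fintype.card V)} :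
    orderedAdj G σ i j = orderedAdj G σ i' j' ↔ (G.Adj (σ i) (σ j) ↔ G.Adj (σ i') (σ j')) := by
  classical
  simp only [orderedAdj, Matrix.submatrix_apply, SimpleGraph.adjMatrix_apply]
  split_ifs <;> simp [*]

theorem transpose_orderedAdj : (orderedAdj G σ).transpose = orderedAdj G σ := by
  classical
  simp only [orderedAdj, Matrix.transpose_submatrix, SimpleGraph.transpose_adjMatrix]

variable {G σ} in
theorem isCorner_orderedAdj_swap {i j : Fin (Fintype.card V)}
    (h : IsCorner (orderedAdj G σ) i j) : IsCorner (orderedAdj G σ) j i :=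
  transpose_orderedAdj G σ ▸ h.transpose

variable {G σ} in
theorem IsMixed.exists_not_homogeneous {σ : Fin (Fintype.card V) ≃ V}
    {A B : Finset (Fin (Fintype.card V))} {X : Finset V} (h : IsMixed (orderedAdj G σ) A B)
    (hA : (A : Set _) ⊆ σ ⁻¹' X) : ∃ y ∈ B, ¬ Homogeneous G X {σ y} := by
  by_contra! hhom
  exact h.1 fun i hi i' hi' j hj => (orderedAdj_eq_iff G σ).2
    ((hhom j hj).adj_iff_of_singleton (hA hi) (hA hi'))

end OrderedAdjacency

section DivisionRefinement

variable {V : Type u} [Fintype V] {G : SimpleGraph V} {σ : Fin (Fintype.card V) ≃ V}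
  {δ : Fin (Fintype.card V) → ℕ} {p K : ℕ}

open Classical in
/-- The label of the part of a vertex, together with the runs in which it has a neighbor outside
mixed zones. -/
noncomputable def vertexCode (G : SimpleGraph V) (σ : Fin (Fintype.card V) ≃ V)
    (δ : Fin (Fintype.card V) → ℕ) (p : ℕ) (u : V) : ℕ × Finset ℕ :=
  (δ (σ.symm u), {w | ¬ ZoneHit (IsCorner (orderedAdj G σ)) δ (δ (σ.symm u)) (δ (σ.symm w)) ∧
    G.Adj u w}.toFinset.image
      fun w => runKey (IsCorner (orderedAdj G σ)) δ p (δ (σ.symm u)) (δ (σ.symm w)))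

/-- The refinement of the division `δ` of the vertices ordered by `σ`. -/
noncomputable def divisionRefinement [DecidableEq V] (G : SimpleGraph V)
    (σ : Fin (Fintype.card V) ≃ V) (δ : Fin (Fintype.card V) → ℕ) :
    Finpartition (univ : Finset V) :=
  refinement G (δ ∘ σ.symm) (ZoneHit (IsCorner (orderedAdj G σ)) δ)

theorem adj_of_vertexCode_eq (hδ : Monotone δ) (hlt : ∀ x, δ x < p) {u v w : V}
    (h : vertexCode G σ δ p u = vertexCode G σ δ p v)
    (hw : ¬ ZoneHit (IsCorner (orderedAdj G σ)) δ (δ (σ.symm u)) (δ (σ.symm w)))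
    (huw : G.Adj u w) : G.Adj v w := by
  classical
  have huv : δ (σ.symm u) = δ (σ.symm v) := congrArg Prod.fst h
  obtain ⟨w', hw', hkey⟩ : ∃ w', G.Adj v w' ∧
      runKey (IsCorner (orderedAdj G σ)) δ p (δ (σ.symm v)) (δ (σ.symm w')) =
        runKey (IsCorner (orderedAdj G σ)) δ p (δ (σ.symm u)) (δ (σ.symm w)) := by
    have hmem : runKey (IsCorner (orderedAdj G σ)) δ p (δ (σ.symm u)) (δ (σ.symm w)) ∈
        (vertexCode G σ δ p u).2 :=
      mem_image_of_mem _ (Set.mem_toFinset.2 ⟨hw, huw⟩)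
    rw [h] at hmem
    obtain ⟨w', hw', hkey⟩ := mem_image.1 hmem
    exact ⟨w', (Set.mem_toFinset.1 hw').2, hkey⟩
  rw [← huv] at hkey
  rcases eq_or_eq_of_runKey_eq hδ hlt huv hw hkey.symm with h | h <;>
    simp only [orderedAdj_eq_iff, Equiv.apply_symm_apply] at h
  · exact h.1 huw
  · exact h.2 hw'

theorem refinementSetoid_of_vertexCode_eq (hδ : Monotone δ) (hlt : ∀ x, δ x < p) {u v : V}
    (h : vertexCode G σ δ p u = vertexCode G σ δ p v) :
    refinementSetoid G (δ ∘ σ.symm) (ZoneHit (IsCorner (orderedAdj G σ)) δ) u v := by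
  have huv : δ (σ.symm u) = δ (σ.symm v) := congrArg Prod.fst h
  exact ⟨huv, fun w hw => ⟨adj_of_vertexCode_eq hδ hlt h hw,
    adj_of_vertexCode_eq hδ hlt h.symm (huv ▸ hw)⟩⟩

theorem vertexCode_mem (hδ : IsSparseDivision (IsCorner (orderedAdj G σ)) p K δ) {L : Finset ℕ}
    {u : V} (hu : δ (σ.symm u) ∈ L) :
    vertexCode G σ δ p u ∈ L ×ˢ (range (2 * K + 1)).powerset := by
  refine mem_product.2 ⟨hu, mem_powerset.2 fun k hk => ?_⟩
  obtain ⟨w, -, rfl⟩ := mem_image.1 hk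
  refine mem_range.2 (Nat.lt_succ_of_le ((runKey_le ..).trans ?_))
  exact Nat.mul_le_mul_left 2 (hδ.card_rowHits_le _)

variable [DecidableEq V] {Q : Finpartition (univ : Finset V)}

theorem card_parts_le_of_labels_mem (hδ : IsSparseDivision (IsCorner (orderedAdj G σ)) p K δ)
    (hQ : divisionRefinement G σ δ ≤ Q) {F : Finset (Finset V)} (hF : F ⊆ Q.parts) {L : Finset ℕ}
    (hL : ∀ Y ∈ F, ∀ y ∈ Y, δ (σ.symm y) ∈ L) : #F ≤ #L * 2 ^ (2 * K + 1) := by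
  classical
  calc #F ≤ #(L ×ˢ (range (2 * K + 1)).powerset) := by
        refine card_le_card_of_forall_subsingleton
          (fun Y k => ∃ y ∈ Y, vertexCode G σ δ p y = k) (fun Y hY => ?_) fun k _ => ?_
        · obtain ⟨y, hy⟩ := Q.nonempty_of_mem_parts (hF hY)
          exact ⟨_, vertexCode_mem hδ (hL Y hY y hy), y, hy, rfl⟩
        · rintro Y ⟨hY, y, hy, rfl⟩ Y' ⟨hY', y', hy', hyy'⟩
          exact eq_of_refinementSetoid hQ (hF hY) (hF hY') hy hy'
            (refinementSetoid_of_vertexCode_eq hδ.monotone hδ.lt hyy'.symm)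
    _ = #L * 2 ^ (2 * K + 1) := by rw [card_product, card_powerset, card_range]

theorem redDegreeWidth_le_of_between {c : ℕ}
    (hδ : IsSparseDivision (IsCorner (orderedAdj G σ)) (p + 1) K δ)
    (hδ' : IsSparseDivision (IsCorner (orderedAdj G σ)) p K (mergeLabel c ∘ δ))
    (hQ : divisionRefinement G σ δ ≤ Q) (hQ' : Q ≤ divisionRefinement G σ (mergeLabel c ∘ δ)) :
    redDegreeWidth G Q ≤ 2 * K * 2 ^ (2 * K + 1) := by
  classical
  refine Finset.sup_le fun X hX => ?_
  obtain ⟨x, hx⟩ := Q.nonempty_of_mem_parts hX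
  set H := rowHits (IsCorner (orderedAdj G σ)) (mergeLabel c ∘ δ) p (mergeLabel c (δ (σ.symm x)))
  calc #{Y ∈ Q.parts | RedEdge G X Y}
      ≤ #{b ∈ range (p + 1) | mergeLabel c b ∈ H} * 2 ^ (2 * K + 1) := by
        refine card_parts_le_of_labels_mem hδ hQ (filter_subset _ _) fun Y hY y hy => ?_
        obtain ⟨hY, hXY⟩ := mem_filter.1 hY
        have hzone := rel_of_redEdge (fun _ _ => ZoneHit.swap fun _ _ => isCorner_orderedAdj_swap)
          hQ' hX hY hXY hx hy
        exact mem_filter.2 ⟨mem_range.2 (hδ.lt _), mem_rowHits.2 ⟨hδ'.lt _, hzone.rowHit⟩⟩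
    _ ≤ 2 * K * 2 ^ (2 * K + 1) := by
        gcongr
        exact (card_filter_mergeLabel_mem_le _ _ _).trans
          (Nat.mul_le_mul_left 2 (hδ'.card_rowHits_le _))

theorem redDegreeWidth_le_of_single_label
    (hδ : IsSparseDivision (IsCorner (orderedAdj G σ)) 1 K δ)
    (hQ : divisionRefinement G σ δ ≤ Q) : redDegreeWidth G Q ≤ 2 ^ (2 * K + 1) := by
  classical
  refine Finset.sup_le fun X _ => ?_
  simpa using card_parts_le_of_labels_mem hδ hQ (filter_subset _ _)
    (L := range 1) fun Y _ y _ => mem_range.2 (hδ.lt _)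

/-- Starting from singletons, merge consecutive parts of the division one pair at a time, and
interpolate between the refinements of successive divisions. -/
theorem exists_chain_to_divisionRefinement {k m p : ℕ}
    (hfree : ¬ HasGridMinor (IsCorner (orderedAdj G σ)) (k + 1)) (hp : 1 ≤ p)
    (hm : m + p = Fintype.card V) :
    ∃ δ, IsSparseDivision (IsCorner (orderedAdj G σ)) p (4 * gridConst k) δ ∧
      Relation.ReflTransGen (fun A B => IsMerge A B ∧ redDegreeWidth G B ≤
        2 * (4 * gridConst k) * 2 ^ (2 * (4 * gridConst k) + 1)) ⊥ (divisionRefinement G σ δ) := by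
  induction m generalizing p with
  | zero =>
    obtain rfl : p = Fintype.card V := by omega
    refine ⟨Fin.val, isSparseDivision_val _ _, ?_⟩
    rw [divisionRefinement,
      refinement_eq_bot_of_injective (Fin.val_injective.comp σ.symm.injective)]
  | succ m ih =>
    obtain ⟨δ, hδ, hchain⟩ := ih (p := p + 1) (by omega) (by omega)
    obtain ⟨c, hδ'⟩ := hδ.exists_mergeLabel hp hfree
    refine ⟨_, hδ', hchain.trans (Relation.ReflTransGen.mono (fun A B h => ⟨h.1, ?_⟩) _ _
      (exists_merge_chain (refinement_le_comp _ fun _ _ => ZoneHit.comp (mergeLabel c))))⟩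
    exact redDegreeWidth_le_of_between hδ hδ' h.2.1 h.2.2

theorem tww_le_of_not_hasMixedMinor [Nonempty V] {t : ℕ}
    (h : ¬ HasMixedMinor (orderedAdj G σ) (t + 1)) :
    tww V G ≤ 2 * (4 * gridConst (2 * t + 1)) * 2 ^ (2 * (4 * gridConst (2 * t + 1)) + 1) := by
  have hfree : ¬ HasGridMinor (IsCorner (orderedAdj G σ)) (2 * t + 1 + 1) := fun hg =>
    h (hasMixedMinor_of_hasGridMinor_isCorner t.succ_pos hg)
  obtain ⟨δ, hδ, hchain⟩ := exists_chain_to_divisionRefinement hfree le_rfl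
    (Nat.sub_add_cancel (Fintype.card_pos (α := V)))
  have hpos := gridConst_pos (2 * t + 1)
  have htop : divisionRefinement G σ δ ≤ .indiscrete (univ_nonempty (α := V)).ne_empty :=
    fun X _ => ⟨univ, mem_singleton_self _, subset_univ X⟩
  obtain ⟨S, hS⟩ := exists_partitionSequence_of_chain (p := fun Q => redDegreeWidth G Q ≤ _) rfl
    (by simp [redDegreeWidth_bot])
    (hchain.trans (Relation.ReflTransGen.mono (fun A B hAB => ⟨hAB.1,
      (redDegreeWidth_le_of_single_label hδ hAB.2.1).trans
        (Nat.le_mul_of_pos_left _ (by omega))⟩) _ _ (exists_merge_chain htop)))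
  exact partitionWidth_le S hS

end DivisionRefinement

section CompatibleOrder

variable {V : Type u} [Fintype V] [DecidableEq V] {P Q : Finpartition (univ : Finset V)}

theorem IsMerge.exists_labels (h : IsMerge Q P) {ℓ : V → ℕ}
    (hP : ∀ W ∈ P.parts, ∃ a, ∀ v, v ∈ W ↔ ℓ v = a) :
    ∃ ℓ' : V → ℕ, (∀ W ∈ Q.parts, ∃ a, ∀ v, v ∈ W ↔ ℓ' v = a) ∧ ∀ v, ℓ' v / 2 = ℓ v := by
  obtain ⟨X, hX, Y, hY, hXY, hparts⟩ := h
  obtain ⟨a, ha⟩ := hP (X ∪ Y) (hparts ▸ mem_insert_self _ _)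
  have hnotMem {W v} (hW : W ∈ Q.parts) (hWY : W ≠ Y) (hv : v ∈ W) : v ∉ Y :=
    fun hvY => hWY (Q.eq_of_mem_parts hW hY hv hvY)
  obtain ⟨ℓ', hℓ'⟩ : ∃ ℓ' : V → ℕ, ∀ v, ℓ' v = 2 * ℓ v + if v ∈ Y then 1 else 0 :=
    ⟨_, fun _ => rfl⟩
  refine ⟨ℓ', fun W hW => ?_, fun v => by grind⟩
  by_cases hWY : W = Y
  · exact ⟨2 * a + 1, fun v => by grind⟩
  by_cases hWX : W = X
  · exact ⟨2 * a, fun v => by grind⟩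
  · obtain ⟨b, hb⟩ := hP W
      (hparts ▸ mem_insert_of_mem (mem_erase.2 ⟨hWY, mem_erase.2 ⟨hWX, hW⟩⟩))
    exact ⟨2 * b, fun v => by grind⟩

theorem exists_compatible_labels (S : PartitionSequence V) {m : ℕ} (hm : 1 ≤ m)
    (hmn : m ≤ Fintype.card V) :
    ∃ ℓ : V → ℕ, (∀ X ∈ (S.part m).parts, ∃ a, ∀ v, v ∈ X ↔ ℓ v = a) ∧
      ∀ i, 1 ≤ i → i ≤ m → ∀ X ∈ (S.part i).parts,
        ∃ I : Set ℕ, I.OrdConnected ∧ (X : Set V) = ℓ ⁻¹' I := by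
  induction m, hm using Nat.le_induction with
  | base =>
    refine ⟨fun _ => 0, fun X hX => ⟨0, ?_⟩,
      fun i hi hi' X hX => ⟨.univ, Set.ordConnected_univ, ?_⟩⟩
    · rw [S.coarsest, mem_singleton] at hX
      simp [hX]
    · obtain rfl := le_antisymm hi' hi
      rw [S.coarsest, mem_singleton] at hX
      simp [hX]
  | succ m hm ih =>
    obtain ⟨ℓ, hfiber, hinterval⟩ := ih (by omega)
    obtain ⟨ℓ', hfiber', hℓ⟩ := (S.merge m hm (by omega)).exists_labels hfiber
    refine ⟨ℓ', hfiber', fun i hi hi' X hX => ?_⟩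
    rcases hi'.lt_or_eq with hlt | rfl
    · obtain ⟨I, hI, hXI⟩ := hinterval i hi (Nat.le_of_lt_succ hlt) X hX
      refine ⟨_, hI.preimage_mono fun _ _ h => Nat.div_le_div_right (c := 2) h, ?_⟩
      rw [hXI, ← Set.preimage_comp]
      exact congrArg (· ⁻¹' I) (funext fun v => (hℓ v).symm)
    · obtain ⟨a, ha⟩ := hfiber' X hX
      exact ⟨{a}, Set.ordConnected_singleton, Set.ext ha⟩

theorem exists_compatible_order [Nonempty V] (S : PartitionSequence V) :
    ∃ σ : Fin (Fintype.card V) ≃ V, ∀ i, 1 ≤ i → i ≤ Fintype.card V →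
      ∀ X ∈ (S.part i).parts, (σ ⁻¹' (X : Set V)).OrdConnected := by
  obtain ⟨ℓ, -, hinterval⟩ := exists_compatible_labels S (m := Fintype.card V)
    Fintype.card_pos le_rfl
  have e := (Fintype.equivFin V).symm
  refine ⟨(Tuple.sort (ℓ ∘ e)).trans e, fun i hi hi' X hX => ?_⟩
  obtain ⟨I, hI, hXI⟩ := hinterval i hi hi' X hX
  rw [hXI]
  exact hI.preimage_mono (Tuple.monotone_sort (ℓ ∘ e))

end CompatibleOrder

section IntervalFamilies

variable {α ι : Type*} [LinearOrder α] {I J : Set α} {D : Finset ι} {B : ι → Set α}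

theorem lt_of_ordConnected_of_disjoint (hI : I.OrdConnected) (hJ : J.OrdConnected)
    (hIJ : Disjoint I J) {i i' j j' : α} (hi : i ∈ I) (hj : j ∈ J) (hij : i < j) (hi' : i' ∈ I)
    (hj' : j' ∈ J) : i' < j' := by
  rw [Set.disjoint_left] at hIJ
  by_contra! h
  rcases le_or_gt j i' with hji' | hi'j
  · exact hIJ (hI.out hi hi' ⟨hij.le, hji'⟩) hj
  · exact hIJ hi' (hJ.out hj' hj ⟨h, hi'j.le⟩)

open Classical in
theorem card_meet_both_le_one (hD : (D : Set ι).PairwiseDisjoint B)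
    (hB : ∀ b ∈ D, (B b).OrdConnected) (hI : I.OrdConnected) (hJ : J.OrdConnected)
    (hIJ : Disjoint I J) : #{b ∈ D | (B b ∩ I).Nonempty ∧ (B b ∩ J).Nonempty} ≤ 1 := by
  refine card_le_one.2 fun b hb b' hb' => by_contra fun hne => ?_
  simp only [mem_filter] at hb hb'
  obtain ⟨hbD, ⟨x, hxb, hxI⟩, y, hyb, hyJ⟩ := hb
  obtain ⟨hbD', ⟨x', hxb', hxI'⟩, y', hyb', hyJ'⟩ := hb'
  have hbb' {z z' w w'} (hz : z ∈ B b) (hz' : z' ∈ B b') (hzz' : z < z') (hw : w ∈ B b)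
      (hw' : w' ∈ B b') : w < w' :=
    lt_of_ordConnected_of_disjoint (hB b hbD) (hB b' hbD') (hD hbD hbD' hne) hz hz' hzz' hw hw'
  rcases (hIJ.ne_of_mem hxI hyJ).lt_or_gt with hxy | hyx
  · have hlt {z z'} (hz : z ∈ I) (hz' : z' ∈ J) : z < z' :=
      lt_of_ordConnected_of_disjoint hI hJ hIJ hxI hyJ hxy hz hz'
    exact (hbb' hxb hyb' (hlt hxI hyJ') hyb hxb').asymm (hlt hxI' hyJ)
  · have hlt {z z'} (hz : z ∈ J) (hz' : z' ∈ I) : z < z' :=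
      lt_of_ordConnected_of_disjoint hJ hI hIJ.symm hyJ hxI hyx hz hz'
    exact (hbb' hyb hxb' (hlt hyJ hxI') hxb hyb').asymm (hlt hyJ' hxI)

open Classical in
theorem card_meet_not_subset_le_two (hD : (D : Set ι).PairwiseDisjoint B)
    (hB : ∀ b ∈ D, (B b).OrdConnected) (hI : I.OrdConnected) :
    #{b ∈ D | (B b ∩ I).Nonempty ∧ ¬ B b ⊆ I} ≤ 2 := by
  set below : Set α := {x | ∀ y ∈ I, x < y}
  set above : Set α := {x | ∀ y ∈ I, y < x}
  have hbelow : #{b ∈ D | (B b ∩ I).Nonempty ∧ (B b ∩ below).Nonempty} ≤ 1 :=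
    card_meet_both_le_one hD hB hI
      (IsLowerSet.ordConnected fun _ _ hyx hx z hz => hyx.trans_lt (hx z hz))
      (Set.disjoint_left.2 fun x hxI hx => (hx x hxI).false)
  have habove : #{b ∈ D | (B b ∩ I).Nonempty ∧ (B b ∩ above).Nonempty} ≤ 1 :=
    card_meet_both_le_one hD hB hI
      (IsUpperSet.ordConnected fun _ _ hxy hx z hz => (hx z hz).trans_le hxy)
      (Set.disjoint_left.2 fun x hxI hx => (hx x hxI).false)
  refine (card_le_card fun b hb => ?_).trans ((card_union_le _ _).trans (add_le_add hbelow habove))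
  obtain ⟨hbD, hmeet, hsub⟩ := mem_filter.1 hb
  obtain ⟨z, hzb, hzI⟩ := Set.not_subset.1 hsub
  have hz : z ∈ below ∨ z ∈ above := by
    by_contra! h
    simp only [below, above, Set.mem_ofPred_eq, not_forall, not_lt] at h
    obtain ⟨⟨y, hy, hyz⟩, y', hy', hzy'⟩ := h
    exact hzI (hI.out hy hy' ⟨hyz, hzy'⟩)
  exact mem_union.2 (hz.imp (fun hz => mem_filter.2 ⟨hbD, hmeet, z, hzb, hz⟩)
    fun hz => mem_filter.2 ⟨hbD, hmeet, z, hzb, hz⟩)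

open Classical in
theorem card_meet_union_le_three (hD : (D : Set ι).PairwiseDisjoint B)
    (hB : ∀ b ∈ D, (B b).OrdConnected) (hI : I.OrdConnected) (hJ : J.OrdConnected)
    (hIJ : Disjoint I J) (hunion : (I ∪ J).OrdConnected)
    (hDI : ∀ b ∈ D, ¬ B b ⊆ I) (hDJ : ∀ b ∈ D, ¬ B b ⊆ J) :
    #{b ∈ D | (B b ∩ (I ∪ J)).Nonempty} ≤ 3 := by
  refine (card_le_card fun b hb => ?_).trans ((card_union_le _ _).trans (add_le_add
    (card_meet_both_le_one hD hB hI hJ hIJ) (card_meet_not_subset_le_two hD hB hunion)))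
  obtain ⟨hbD, hmeet⟩ := mem_filter.1 hb
  by_cases hsub : B b ⊆ I ∪ J
  · obtain ⟨x, hx, hxI⟩ := Set.not_subset.1 (hDI b hbD)
    obtain ⟨y, hy, hyJ⟩ := Set.not_subset.1 (hDJ b hbD)
    exact mem_union_left _ (mem_filter.2 ⟨hbD, ⟨y, hy, (hsub hy).resolve_right hyJ⟩,
      x, hx, (hsub hx).resolve_left hxI⟩)
  · exact mem_union_right _ (mem_filter.2 ⟨hbD, hmeet, hsub⟩)

end IntervalFamilies

section MixedMinorFree

variable {V : Type u} [Fintype V] [DecidableEq V] {G : SimpleGraph V}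
  {P Q : Finpartition (univ : Finset V)} {d : ℕ}

/-- A member of the family that meets a part other than `X` in a vertex splitting `X` witnesses a
red arc, and each part is met by few members since it contains none of them. -/
theorem IsMerge.card_le_of_not_homogeneous {α ι : Type*} [LinearOrder α] {D : Finset ι}
    {B : ι → Set α} {σ : α → V} {X : Finset V} (h : IsMerge Q P)
    (hQ : ∀ Z ∈ Q.parts, (σ ⁻¹' (Z : Set V)).OrdConnected)
    (hP : ∀ Z ∈ P.parts, (σ ⁻¹' (Z : Set V)).OrdConnected)
    (hX : X ∈ P.parts) (hXQ : X ∉ Q.parts) (hD : (D : Set ι).PairwiseDisjoint B)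
    (hB : ∀ b ∈ D, (B b).OrdConnected) (hsplit : ∀ b ∈ D, ∃ y ∈ B b, ¬ Homogeneous G X {σ y})
    (hsub : ∀ Z ∈ Q.parts, ∀ b ∈ D, ¬ B b ⊆ σ ⁻¹' Z) : #D ≤ 3 + 2 * redOutDegreeWidth G P := by
  classical
  obtain ⟨Y, hY, Y', hY', hne, hparts⟩ := h
  have hrest {Z} (hZ : Z ∈ P.parts) : Z = Y ∪ Y' ∨ Z ∈ Q.parts :=
    (mem_insert.1 (hparts ▸ hZ)).imp_right fun hZ => mem_of_mem_erase (mem_of_mem_erase hZ)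
  obtain rfl : X = Y ∪ Y' := (hrest hX).resolve_right hXQ
  set red := {Z ∈ P.parts | RedArc G (Y ∪ Y') Z}
  set meet := fun Z : Finset V => {b ∈ D | (B b ∩ σ ⁻¹' Z).Nonempty} with hmeet
  have hcover : D ⊆ meet (Y ∪ Y') ∪ red.biUnion meet := fun b hb => by
    obtain ⟨y, hyb, hy⟩ := hsplit b hb
    obtain ⟨Z, hZ, hyZ⟩ := P.exists_mem (mem_univ (σ y))
    have hbZ : b ∈ meet Z := mem_filter.2 ⟨hb, y, hyb, hyZ⟩
    by_cases hZX : Z = Y ∪ Y'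
    · exact mem_union_left _ (hZX ▸ hbZ)
    · exact mem_union_right _ (mem_biUnion.2
        ⟨Z, mem_filter.2 ⟨hZ, Ne.symm hZX, fun hhom => hy (hhom _ hyZ)⟩, hbZ⟩)
  have hmerged : #(meet (Y ∪ Y')) ≤ 3 := by
    have hdisj : Disjoint (σ ⁻¹' (Y : Set V)) (σ ⁻¹' (Y' : Set V)) :=
      (disjoint_coe.2 (Q.disjoint hY hY' hne)).preimage σ
    have hconn := hP _ hX
    simp only [hmeet, coe_union, Set.preimage_union] at hconn ⊢
    exact card_meet_union_le_three hD hB (hQ Y hY) (hQ Y' hY') hdisj hconn (hsub Y hY) (hsub Y' hY')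
  have hother : ∀ Z ∈ red, #(meet Z) ≤ 2 := fun Z hZred => by
    obtain ⟨hZ, hZX, -⟩ := mem_filter.1 hZred
    have hZQ : Z ∈ Q.parts := (hrest hZ).resolve_left hZX.symm
    refine (card_le_card fun b hb => ?_).trans (card_meet_not_subset_le_two hD hB (hQ Z hZQ))
    obtain ⟨hbD, hbZ⟩ := mem_filter.1 hb
    exact mem_filter.2 ⟨hbD, hbZ, hsub Z hZQ b hbD⟩
  calc #D ≤ #(meet (Y ∪ Y')) + #(red.biUnion meet) := (card_le_card hcover).trans (card_union_le ..)
    _ ≤ 3 + #red * 2 := add_le_add hmerged (card_biUnion_le_card_mul _ _ _ hother)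
    _ ≤ 3 + 2 * redOutDegreeWidth G P := by
      rw [mul_comm]
      gcongr
      exact card_redArc_le_redOutDegreeWidth G hX

theorem exists_and_not_succ {p : ℕ → Prop} {m n : ℕ} (hmn : m ≤ n) (hm : p m) (hn : ¬ p n) :
    ∃ i, m ≤ i ∧ i < n ∧ p i ∧ ¬ p (i + 1) := by
  by_contra! hstep
  have hall (i) (hi : m ≤ i) : i ≤ n → p i := by
    induction i, hi using Nat.le_induction with
    | base => exact fun _ => hm
    | succ i hi ih => exact fun h => hstep i hi h (ih (Nat.le_of_succ_le h))
  exact hn (hall n hmn le_rfl)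

/-- Consider the first merge that produces a part containing a row part or a column part. -/
theorem not_hasMixedMinor_of_redOutDegreeWidth_lt [Nonempty V] {S : PartitionSequence V}
    (hS : ∀ i, 1 ≤ i → i ≤ Fintype.card V → redOutDegreeWidth G (S.part i) < d)
    {σ : Fin (Fintype.card V) ≃ V}
    (hσ : ∀ i, 1 ≤ i → i ≤ Fintype.card V →
      ∀ X ∈ (S.part i).parts, (σ ⁻¹' (X : Set V)).OrdConnected) :
    ¬ HasMixedMinor (orderedAdj G σ) (2 * d + 2) := by
  rintro ⟨R, C, hR, hC, hRcard, hCcard, hmix⟩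
  have hmix' : ∀ A ∈ C.parts, ∀ B ∈ R.parts, IsMixed (orderedAdj G σ) A B := fun A hA B hB =>
    transpose_orderedAdj G σ ▸ isMixed_transpose.2 (hmix B hB A hA)
  obtain ⟨A₀, hA₀⟩ : R.parts.Nonempty := card_pos.1 (by omega)
  obtain ⟨B₀, hB₀⟩ : C.parts.Nonempty := card_pos.1 (by omega)
  set Covers : ℕ → Prop := fun i => ∃ X ∈ (S.part i).parts, ∃ A,
    (A ∈ R.parts ∨ A ∈ C.parts) ∧ (A : Set _) ⊆ σ ⁻¹' (X : Set V)
  have hfirst : Covers 1 := ⟨univ, by simp [S.coarsest], A₀, .inl hA₀, by simp⟩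
  have hlast : ¬ Covers (Fintype.card V) := by
    rintro ⟨X, hX, A, hA, hAX⟩
    rw [S.finest] at hX
    obtain ⟨x, -, rfl⟩ := Finpartition.mem_bot_iff.1 hX
    obtain ⟨B, hAB⟩ : ∃ B, IsMixed (orderedAdj G σ) A B :=
      hA.elim (fun hA => ⟨B₀, hmix A hA B₀ hB₀⟩) fun hA => ⟨A₀, hmix' A hA A₀ hA₀⟩
    obtain ⟨y, -, hy⟩ := hAB.exists_not_homogeneous hAX
    exact hy (by simpa [Homogeneous] using em (G.Adj x (σ y)))
  obtain ⟨i, hi, hin, ⟨X, hX, A, hA, hAX⟩, hnext⟩ :=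
    exists_and_not_succ Fintype.card_pos hfirst hlast
  have hXnext : X ∉ (S.part (i + 1)).parts := fun h => hnext ⟨X, h, A, hA, hAX⟩
  have hcard {D : Finpartition univ} (hD : IsDivision D)
      (hAD : ∀ B ∈ D.parts, IsMixed (orderedAdj G σ) A B)
      (hsub : ∀ B ∈ D.parts, B ∈ R.parts ∨ B ∈ C.parts) : #D.parts < 2 * d + 2 := by
    have := (S.merge i hi hin).card_le_of_not_homogeneous (hσ (i + 1) (by omega) hin)
      (hσ i hi hin.le) hX hXnext (D := D.parts)
      (B := fun B => (B : Set (Fin (Fintype.card V))))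
      (fun B hB B' hB' hne => disjoint_coe.2 (D.disjoint hB hB' hne)) hD
      (fun B hB => (hAD B hB).exists_not_homogeneous hAX)
      fun Z hZ B hB hBZ => hnext ⟨Z, hZ, B, hsub B hB, hBZ⟩
    have := hS i hi hin.le
    omega
  rcases hA with hA | hA
  · exact (hcard hC (hmix A hA) fun _ => .inr).ne hCcard
  · exact (hcard hR (hmix' A hA) fun _ => .inl).ne hRcard

theorem exists_not_hasMixedMinor_of_otww_lt [Nonempty V] (h : otww V G < d) :
    ∃ σ : Fin (Fintype.card V) ≃ V, ¬ HasMixedMinor (orderedAdj G σ) (2 * d + 2) := by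
  obtain ⟨S, hS⟩ := exists_sequence_le_partitionWidth redOutDegreeWidth G
  obtain ⟨σ, hσ⟩ := exists_compatible_order S
  exact ⟨σ, not_hasMixedMinor_of_redOutDegreeWidth_lt (fun i hi hi' => (hS i hi hi').trans_lt h) hσ⟩

theorem le_otww_of_lt_mixedValue [Nonempty V] (h : 2 * d + 2 < mixedValue G) : d ≤ otww V G := by
  by_contra! hlt
  exact Nat.notMem_of_lt_sInf h ⟨by omega, exists_not_hasMixedMinor_of_otww_lt hlt⟩

theorem tww_le_of_otww [Nonempty V] (G : SimpleGraph V) :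
    tww V G ≤ 2 * (4 * gridConst (4 * otww V G + 7)) *
      2 ^ (2 * (4 * gridConst (4 * otww V G + 7)) + 1) := by
  obtain ⟨σ, hσ⟩ := exists_not_hasMixedMinor_of_otww_lt (Nat.lt_succ_self (otww V G))
  have h := tww_le_of_not_hasMixedMinor (t := 2 * otww V G + 3) hσ
  rwa [show 2 * (2 * otww V G + 3) + 1 = 4 * otww V G + 7 by ring] at h

end MixedMinorFree

section Bounds

theorem gridConst_le (k : ℕ) : gridConst k ≤ 2 ^ (7 * k + 9) := by
  calc gridConst k = 8 * ((k + 1) * 4 ^ (2 * k + 2)) * 2 ^ (2 * k + 2) := rfl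
    _ ≤ 8 * (2 ^ k * 4 ^ (2 * k + 2)) * 2 ^ (2 * k + 2) := by
      gcongr
      exact Nat.lt_two_pow_self
    _ = 2 ^ (7 * k + 9) := by
      rw [show 4 ^ (2 * k + 2) = 2 ^ (4 * k + 4) by rw [show 4 = 2 ^ 2 by rfl, ← pow_mul]; ring_nf]
      ring

theorem tww_le_two_pow_two_pow {V : Type u} [Fintype V] [DecidableEq V] [Nonempty V]
    (G : SimpleGraph V) : tww V G ≤ 2 ^ 2 ^ (91 * otww V G) := by
  rcases Nat.eq_zero_or_pos (otww V G) with hzero | hpos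
  · exact (tww_eq_zero_of_otww_eq_zero hzero).trans_le (Nat.zero_le _)
  set w := otww V G
  set C := gridConst (4 * w + 7)
  have hC : 0 < C := gridConst_pos _
  have hexponent : 16 * C + 1 ≤ 2 ^ (91 * w) := by
    calc 16 * C + 1 ≤ 2 ^ 5 * C := by omega
      _ ≤ 2 ^ 5 * 2 ^ (7 * (4 * w + 7) + 9) := Nat.mul_le_mul_left _ (gridConst_le _)
      _ = 2 ^ (28 * w + 63) := by ring
      _ ≤ 2 ^ (91 * w) := Nat.pow_le_pow_right two_pos (by omega)
  calc tww V G ≤ 2 * (4 * C) * 2 ^ (2 * (4 * C) + 1) := tww_le_of_otww G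
    _ ≤ 2 ^ (2 * (4 * C)) * 2 ^ (2 * (4 * C) + 1) := by
      gcongr
      exact Nat.lt_two_pow_self.le
    _ = 2 ^ (16 * C + 1) := by ring
    _ ≤ 2 ^ 2 ^ (91 * w) := Nat.pow_le_pow_right two_pos hexponent

theorem two_pow_le_exp (m : ℕ) : (2 : ℝ) ^ m ≤ Real.exp m := by
  rw [← Real.exp_one_pow]
  exact pow_le_pow_left₀ two_pos.le (by linarith [Real.add_one_le_exp (1 : ℝ)]) m

theorem tww_le_exp_exp {V : Type u} [Fintype V] [DecidableEq V] [Nonempty V]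
    (G : SimpleGraph V) : (tww V G : ℝ) ≤ Real.exp (Real.exp (91 * otww V G)) := by
  calc (tww V G : ℝ) ≤ 2 ^ 2 ^ (91 * otww V G) := mod_cast tww_le_two_pow_two_pow G
    _ ≤ Real.exp ((2 : ℝ) ^ (91 * otww V G)) := mod_cast two_pow_le_exp _
    _ ≤ Real.exp (Real.exp (91 * otww V G)) :=
      Real.exp_le_exp.2 (mod_cast two_pow_le_exp (91 * otww V G))

end Bounds

end TwinWidth

theorem theorem3 :
    TwinWidth.FunctionallyEquivalent.{u} TwinWidth.otww TwinWidth.tww ∧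
    (∃ c : ℝ, ∀ (V : Type u) [Fintype V] [DecidableEq V] [Nonempty V] (G : SimpleGraph V),
      TwinWidth.otww V G ≤ TwinWidth.tww V G ∧
      (TwinWidth.tww V G : ℝ) ≤ Real.exp (Real.exp (c * (TwinWidth.otww V G : ℝ)))) ∧
    (∀ (V : Type u) [Fintype V] [DecidableEq V] [Nonempty V] (G : SimpleGraph V) (d : ℕ),
      2 * d + 2 < TwinWidth.mixedValue G → d ≤ TwinWidth.otww V G) := by
  refine ⟨⟨fun x => x + 2 ^ 2 ^ (91 * x), fun V _ _ _ G => ⟨?_, ?_⟩⟩,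
    ⟨91, fun V _ _ _ G => ⟨TwinWidth.otww_le_tww G, TwinWidth.tww_le_exp_exp G⟩⟩,
    fun V _ _ _ G d => TwinWidth.le_otww_of_lt_mixedValue⟩
  · exact (TwinWidth.otww_le_tww G).trans (Nat.le_add_right _ _)
  · exact (TwinWidth.tww_le_two_pow_two_pow G).trans (Nat.le_add_left _ _)
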